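/- Let $\mathbb A=\mathbb R$ or $\mathbb C$, let $n,d\ge 0$ and $0\le s\le n$ be integers; points and algebraic sets in $\mathbb P^n$ are taken over $\mathbb A$. A $d^{\{n\}}$-cage $\mathsf K\subset\mathbb P^n$ is a configuration of $n$ groups (colors) of $d$ hyperplanes $H_{j,i}$ ($1\le j\le n$, $0\le i\le d-1$) that generates exactly $d^n$ points at which $n$ hyperplanes, one of each color, intersect transversally. These points are the nodes of $\mathsf K$, and $\mathsf N$ is the set of nodes. A set $\mathsf A\subset\mathsf N$ is supra-simplicial if, for some orderings of the hyperplanes within each color, $\mathsf A$ consists of the nodes $H_{1,i_1}\cap\dots\cap H_{n,i_n}$ with $0\le i_j\le d-1$ and $i_1+\dots+i_n\le d$. A Zariski closed set $V\subset\mathbb P^n$ is a complete intersection of multidegree $(d_1,\dots,d_k)$ if all its irreducible components have dimension $n-k$, and $V=H_1\cap\dots\cap H_k$ for hypersurfaces $H_j$ (zero sets of nonzero homogeneous polynomials $f_j$) of degrees $d_1,\dots,d_k$ such that, at a generic point $x$ of each component of $V$, the tangent hyperspaces $T_xH_j=\ker d_xf_j\subset T_x\mathbb P^n$ are in general position (their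 intersection has codimension $k$). $T_xV\subset T_x\mathbb P^n$ denotes the Zariski tangent space, cut out by the differentials of all homogeneous polynomials vanishing on $V$. $\mathrm{Gr}_{\mathbb A}(T,k)$ denotes the Grassmannian of $k$-dimensional subspaces of $T$. Let $\mathsf K\subset\mathbb P^n$ be a $d^{\{n\}}$-cage and $p\in\mathsf N$ a node. 1. For every $(n-s)$-dimensional vector subspace $\tau_p\subset T_p(\mathbb P^n)$ there exists a unique complete intersection $V=V(\tau_p)\subset\mathbb P^n$ of multidegree $(\underbrace{d,\dots,d}_{s})$ (hence of dimension $n-s$) that contains all the nodes of $\mathsf K$ and satisfies $T_pV=\tau_p$. 2. For every supra-simplicial set $\mathsf A$ of nodes of $\mathsf K$ and every such $\tau_p$, there is a unique complete intersection of multidegree $(d,\dots,d)$ ($s$ entries) that contains $\mathsf A$ and has tangent space $\tau_p$ at $p$ (it is therefore $V(\tau_p)$). 3. For every $\tau_p$ and every node $q\neq p$, the tangent space $T_q(V(\tau_p))$ has dimension $n-s$; thus $\tau_p\mapsto \big(T_q(V(\tau_p))\big)_{q}$ is a well-defined map $$\Delta_{\mathsf K}:\ \mathrm{Gr}_{\mathbb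 A}\big(T_p(\mathbb P^n),\,n-s\big)\longrightarrow\prod_{q\in\mathsf N\setminus p}\mathrm{Gr}_{\mathbb A}\big(T_q(\mathbb P^n),\,n-s\big).$$ If $d\ge 2$, then $\Delta_{\mathsf K}$ is an embedding of algebraic varieties: it is injective and regular, its image is Zariski closed, and its inverse is regular on the image. -/

import Mathlib

open scoped LinearAlgebra.Projectivization

namespace CageVarieties

/-! ### Projective space, algebraic sets, components and dimension -/

/-- The projective `n`-space over `K`: the lines through the origin in `K^(n+1)`. -/
abbrev PSpace (K : Type*) [Field K] (n : ℕ) : Type _ := ℙ K (Fin (n + 1) → K)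

section Projective

variable {K : Type*} [Field K] {n : ℕ}

/-- The (homogeneous) polynomial `f` vanishes at the point `x`, i.e. on the whole line `x`. -/
def Vanishes (f : MvPolynomial (Fin (n + 1)) K) (x : PSpace K n) : Prop :=
  ∀ v ∈ x.submodule, MvPolynomial.eval v f = 0

/-- The homogeneous polynomials (of all degrees) that vanish on `V`. -/
def vanishingForms (V : Set (PSpace K n)) : Set (MvPolynomial (Fin (n + 1)) K) :=
  {f | (∃ m, f.IsHomogeneous m) ∧ ∀ x ∈ V, Vanishes f x}

/-- Zariski closed subsets: common zero sets of homogeneous polynomials. -/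
def IsAlgebraicSet (V : Set (PSpace K n)) : Prop :=
  ∃ F : Set (MvPolynomial (Fin (n + 1)) K),
    (∀ f ∈ F, ∃ m, f.IsHomogeneous m) ∧ V = {x | ∀ f ∈ F, Vanishes f x}

/-- Irreducible Zariski closed subsets. -/
def IsIrreducibleSet (Z : Set (PSpace K n)) : Prop :=
  IsAlgebraicSet Z ∧ Z.Nonempty ∧
    ∀ A B : Set (PSpace K n), IsAlgebraicSet A → IsAlgebraicSet B → Z ⊆ A ∪ B → Z ⊆ A ∨ Z ⊆ B

/-- `Z` is an irreducible component of `V`: a maximal irreducible Zariski closed subset of `V`. -/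
def IsComponent (V Z : Set (PSpace K n)) : Prop :=
  Maximal (fun Y : Set (PSpace K n) => IsIrreducibleSet Y ∧ Y ⊆ V) Z

/-- The dimension of `V`: the supremum of the lengths of chains
`Y₀ ⊂ Y₁ ⊂ ⋯ ⊂ Yₘ` of irreducible Zariski closed subsets of `V`. -/
noncomputable def dim (V : Set (PSpace K n)) : WithBot ℕ∞ :=
  Order.krullDim {Y : Set (PSpace K n) // IsIrreducibleSet Y ∧ Y ⊆ V}

/-! ### Tangent spaces -/

/-- The tangent space `T_x ℙⁿ = Hom(ℓ, K^(n+1) / ℓ)`, where `ℓ` is the line `x`. -/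
abbrev Tangent (x : PSpace K n) : Type _ :=
  x.submodule →ₗ[K] ((Fin (n + 1) → K) ⧸ x.submodule)

/-- The differential of the polynomial `f` at the vector `v` of `K^(n+1)`. -/
noncomputable def differential (f : MvPolynomial (Fin (n + 1)) K) (v : Fin (n + 1) → K) :
    (Fin (n + 1) → K) →ₗ[K] K :=
  ∑ i, MvPolynomial.eval v (MvPolynomial.pderiv i f) • LinearMap.proj i

/-- The subspace of `T_x ℙⁿ` on which the differentials of all `f ∈ F` vanish, for a set `F` of
homogeneous polynomials that vanish at `x`: it consists of the `φ : ℓ → K^(n+1) / ℓ` such that, for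
`v ∈ ℓ`, the differentials at `v` of the members of `F` (they vanish on `ℓ`, by Euler's
identity, hence descend to `K^(n+1) / ℓ`) vanish on `φ v`. -/
noncomputable def tangentCut (F : Set (MvPolynomial (Fin (n + 1)) K)) (x : PSpace K n) :
    Submodule K (Tangent x) :=
  ⨅ v : x.submodule,
    ((⨅ f ∈ F, LinearMap.ker (differential f (v : Fin (n + 1) → K))).map x.submodule.mkQ).comap
      (LinearMap.applyₗ v)

/-- The Zariski tangent space `T_x V` of the algebraic set `V` at its point `x`. -/
noncomputable def tangentSpace (V : Set (PSpace K n)) (x : PSpace K n) :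
    Submodule K (Tangent x) :=
  tangentCut (vanishingForms V) x

/-- `V` is a complete intersection of type `δ = (δ₁, …, δₖ)` in `ℙⁿ`: it is purely
`(n-k)`-dimensional, and it is the intersection of hypersurfaces `{f₁ = 0}, …, {fₖ = 0}` of degrees
`δ₁, …, δₖ` whose tangent hyperspaces at `x` are in general position in `T_x ℙⁿ` (their
intersection has codimension `k`) for all `x` in a nonempty Zariski open subset `Z \ B` of each
component `Z` of `V`. -/
def IsCompleteIntersection {k : ℕ} (δ : Fin k → ℕ) (V : Set (PSpace K n)) : Prop :=
  (∀ Z, IsComponent V Z → dim Z + (k : WithBot ℕ∞) = (n : WithBot ℕ∞)) ∧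
  ∃ f : Fin k → MvPolynomial (Fin (n + 1)) K,
    (∀ j, f j ≠ 0 ∧ (f j).IsHomogeneous (δ j)) ∧
    V = {x | ∀ j, Vanishes (f j) x} ∧
    ∀ Z, IsComponent V Z → ∃ B, IsAlgebraicSet B ∧ ¬ Z ⊆ B ∧ ∀ x ∈ Z, x ∉ B →
      Module.finrank K ↥(⨅ j, tangentCut {f j} x) + k = n

end Projective

/-! ### Cages -/

/-- The points of `ℙⁿ` at which some `n` hyperplanes, one from each of the `n` groups
`H 0, …, H (n-1)`, intersect transversally. A hyperplane of `ℙⁿ` is given as a linear hyperplane of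
`K^(n+1)`; `n` of them intersect transversally at `x` iff their intersection is the line `x`. -/
def nodeSet {K : Type*} [Field K] {n d : ℕ}
    (H : Fin n → Fin d → Submodule K (Fin (n + 1) → K)) : Set (PSpace K n) :=
  {x | ∃ c : Fin n → Fin d, x.submodule = ⨅ j, H j (c j)}

/-- A `d^{n}`-cage in `ℙⁿ`: `n` groups (colors) of `d` hyperplanes each, which generate exactly
`d^n` points where hyperplanes of all the `n` colors intersect transversally. -/
structure Cage (K : Type*) [Field K] (n d : ℕ) where
  /-- the `i`-th hyperplane of the color `j` -/
  H : Fin n → Fin d → Submodule K (Fin (n + 1) → K)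
  finrank_H : ∀ j i, Module.finrank K (H j i) = n
  ncard_nodeSet : (nodeSet H).ncard = d ^ n

/-- The nodes of a cage. -/
def Cage.nodes {K : Type*} [Field K] {n d : ℕ} (C : Cage K n d) : Set (PSpace K n) :=
  nodeSet C.H

/-- `A` is a supra-simplicial set of nodes: for some orderings `σ j` of the groups of hyperplanes,
`A` consists of the nodes with multi-index `c` such that `c₁ + ⋯ + cₙ ≤ d`, where the hyperplanes
of each color are numbered from `0` to `d - 1`. -/
def Cage.IsSupraSimplicial {K : Type*} [Field K] {n d : ℕ} (C : Cage K n d)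
    (A : Set (PSpace K n)) : Prop :=
  ∃ σ : Fin n → Equiv.Perm (Fin d),
    A = {x | ∃ c : Fin n → Fin d, (∑ j, (c j : ℕ)) ≤ d ∧ x.submodule = ⨅ j, C.H j (σ j (c j))}

/-! ### Grassmannians as algebraic varieties

The Grassmannian `Gr(T, k)` is the quotient of the variety of `k`-frames of `T` (a Zariski open
subset of the vector space `T^k`) by `GL_k`. The projection from frames to subspaces is Zariski
locally trivial. So a subset of a product of Grassmannians is Zariski closed iff
its preimage in the product of the varieties of frames is, and a map to a Grassmannian is regular
iff it lifts, Zariski locally, to a polynomial map of frames (denominators can be cleared, since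
a nonzero multiple of a frame spans the same subspace). -/

/-- The Grassmannian of the `k`-dimensional subspaces of `T`. -/
abbrev Gr (K : Type*) [Field K] (T : Type*) [AddCommGroup T] [Module K T] (k : ℕ) : Type _ :=
  {W : Submodule K T // Module.finrank K W = k}

/-- The subspace spanned by a `k`-frame. -/
def Gr.ofFrame {K : Type*} [Field K] {T : Type*} [AddCommGroup T] [Module K T] {k : ℕ}
    (v : Fin k → T) (hv : LinearIndependent K v) : Gr K T k :=
  ⟨Submodule.span K (Set.range v), by simpa using finrank_span_eq_card hv⟩

/-- The algebra of polynomial functions on a finite-dimensional vector space. -/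
def polyFunctions (K : Type*) [Field K] (M : Type*) [AddCommGroup M] [Module K M] :
    Subalgebra K (M → K) :=
  Algebra.adjoin K (Set.range fun φ : Module.Dual K M => (φ : M → K))

/-- Polynomial maps between finite-dimensional vector spaces. -/
def IsPolynomialMap (K : Type*) [Field K] {M N : Type*} [AddCommGroup M] [Module K M]
    [AddCommGroup N] [Module K N] (g : M → N) : Prop :=
  ∀ φ : Module.Dual K N, (fun v => φ (g v)) ∈ polyFunctions K M

section Grassmannian

variable {K : Type*} [Field K] {k : ℕ}
  {T : Type*} [AddCommGroup T] [Module K T]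
  {ι : Type*} {S : ι → Type*} [∀ i, AddCommGroup (S i)] [∀ i, Module K (S i)]

/-- Regular maps `Gr(T, k) → Gr(T', k)`. -/
def IsRegularMap {T' : Type*} [AddCommGroup T'] [Module K T']
    (F : Gr K T k → Gr K T' k) : Prop :=
  ∀ v₀ : Fin k → T, LinearIndependent K v₀ →
    ∃ g : (Fin k → T) → (Fin k → T'), IsPolynomialMap K g ∧ LinearIndependent K (g v₀) ∧
      ∀ (v : Fin k → T) (hv : LinearIndependent K v) (hg : LinearIndependent K (g v)),
        F (Gr.ofFrame v hv) = Gr.ofFrame (g v) hg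

/-- `G`, restricted to the subset `Y` of the product `∏ Gr(Sᵢ, k)`, is regular: near every point of
`Y` it is given by polynomials in the frames. -/
def IsRegularOn (Y : Set (∀ i, Gr K (S i) k)) (G : (∀ i, Gr K (S i) k) → Gr K T k) : Prop :=
  ∀ (w₀ : ∀ i, Fin k → S i) (hw₀ : ∀ i, LinearIndependent K (w₀ i)),
    (fun i => Gr.ofFrame (w₀ i) (hw₀ i)) ∈ Y →
    ∃ g : (∀ i, Fin k → S i) → (Fin k → T), IsPolynomialMap K g ∧ LinearIndependent K (g w₀) ∧
      ∀ (w : ∀ i, Fin k → S i) (hw : ∀ i, LinearIndependent K (w i))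
        (hg : LinearIndependent K (g w)),
        (fun i => Gr.ofFrame (w i) (hw i)) ∈ Y →
        G (fun i => Gr.ofFrame (w i) (hw i)) = Gr.ofFrame (g w) hg

/-- `Y` is Zariski closed in the product `∏ Gr(Sᵢ, k)`. -/
def IsZariskiClosed (Y : Set (∀ i, Gr K (S i) k)) : Prop :=
  ∃ E : Set ((∀ i, Fin k → S i) → K), E ⊆ (polyFunctions K (∀ i, Fin k → S i) : Set _) ∧
    ∀ (w : ∀ i, Fin k → S i) (hw : ∀ i, LinearIndependent K (w i)),
      (fun i => Gr.ofFrame (w i) (hw i)) ∈ Y ↔ ∀ e ∈ E, e w = 0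

/-- `Δ` is a (closed) embedding of algebraic varieties `Gr(T, k) → ∏ Gr(Sᵢ, k)`: it is injective
and regular, with Zariski closed image, and its inverse is regular on the image. -/
def IsGrassmannianEmbedding (Δ : Gr K T k → ∀ i, Gr K (S i) k) : Prop :=
  Function.Injective Δ ∧
  (∀ i, IsRegularMap fun τ => Δ τ i) ∧
  IsZariskiClosed (Set.range Δ) ∧
  ∃ G : (∀ i, Gr K (S i) k) → Gr K T k,
    Function.LeftInverse G Δ ∧ IsRegularOn (Set.range Δ) G

end Grassmannian

end CageVarieties

namespace CageVarieties

open MvPolynomial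

/-! ### Evaluation along lines -/

section Lines

variable {K : Type*} [Field K] {n : ℕ}

/-! Let f_j be the product of the d linear forms of color j. Exactly one hyperplane of each color
passes through a node, so at every node the differentials of f_1, …, f_n form a basis of the
cotangent space.

Interpolation (`mem_span_colorForm`): modulo the f_j, a form of degree m is a combination of Newton
products, whose values at the nodes are triangular. Hence it lies in (f_1, …, f_n) as soon as it
vanishes at the nodes of index sum at most m. For m = d, the forms of degree d through a
supra-simplicial set are exactly the combinations ∑ l_j f_j with constant l_j.

So a complete intersection as required is the base locus of an s-dimensional space Λ of coefficient
vectors l (`IsNodal.eq_baseLocus`). In the coordinates df_j on the tangent space at p its tangent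
space is the orthogonal complement of Λ; hence τ determines Λ. At any other node q the coordinates
df_j give the same complement (`IsNodal.tangentSpace_baseLocus`). Thus Δ is, in each factor, induced
by a fixed linear isomorphism of T_p with T_q, and such a map is an embedding.

It remains to see that a base locus really is a complete intersection with that tangent space, even
over ℝ, where the Nullstellensatz fails. After a change of basis it is {f_1 = ⋯ = f_s = 0}. Near a
node the f_i are part of an analytic coordinate system, so the polynomials vanishing on the germ of
{f_1 = ⋯ = f_k = 0} form a prime ideal, which does not contain f_{k+1}. Descending induction from k
= n shows that a form lying in the germ ideals of all nodes lies in (f_1, …, f_k)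
(`IsNodal.mem_firstIdeal`). Consequently the f_i are a regular sequence, the components are the
Zariski closures of the germs at the nodes, heights of primes give their dimension, and all forms
vanishing on the locus lie in (f_1, …, f_s), which computes the tangent spaces. -/

theorem eval_smul_of_isHomogeneous {σ : Type*} {f : MvPolynomial σ K} {m : ℕ}
    (hf : f.IsHomogeneous m) (t : K) (v : σ → K) : eval (t • v) f = t ^ m * eval v f := by
  rw [eval_eq, eval_eq, Finset.mul_sum]
  refine Finset.sum_congr rfl fun d hd => ?_
  have hdeg : ∑ i ∈ d.support, d i = m := by
    by_contra h
    exact (mem_support_iff.mp hd) (hf.coeff_eq_zero (by rwa [Finsupp.degree_apply]))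
  simp only [Pi.smul_apply, smul_eq_mul, mul_pow, Finset.prod_mul_distrib]
  rw [Finset.prod_pow_eq_pow_sum, hdeg]
  ring

/-- The restriction of a polynomial to the line spanned by `v`. -/
noncomputable def restrictLine {σ : Type*} (v : σ → K) : MvPolynomial σ K →ₐ[K] Polynomial K :=
  aeval fun i => Polynomial.C (v i) * Polynomial.X

theorem eval_restrictLine {σ : Type*} (v : σ → K) (f : MvPolynomial σ K) (t : K) :
    (restrictLine v f).eval t = eval (t • v) f := by
  induction f using MvPolynomial.induction_on with
  | C a => simp [restrictLine, Polynomial.algebraMap_eq]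
  | add p q hp hq => simp [hp, hq]
  | mul_X p i hp =>
    rw [map_mul, Polynomial.eval_mul, hp, map_mul, eval_X, Pi.smul_apply, smul_eq_mul, mul_comm t]
    simp [restrictLine]

theorem mem_submodule_iff {x : PSpace K n} {v w : Fin (n + 1) → K} (hv : v ∈ x.submodule)
    (h0 : v ≠ 0) : w ∈ x.submodule ↔ ∃ t : K, t • v = w := by
  have h : x.submodule = Submodule.span K {v} := by
    rw [x.submodule_eq, Submodule.mem_span_singleton] at hv
    obtain ⟨t, rfl⟩ := hv
    have ht : t ≠ 0 := by rintro rfl; simp at h0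
    rw [x.submodule_eq, Submodule.span_singleton_smul_eq (IsUnit.mk0 t ht)]
  rw [h, Submodule.mem_span_singleton]

theorem rep_mem_submodule (x : PSpace K n) : x.rep ∈ x.submodule := by
  rw [x.submodule_eq]; exact Submodule.mem_span_singleton_self _

theorem vanishes_iff_eval {f : MvPolynomial (Fin (n + 1)) K} {m : ℕ} (hf : f.IsHomogeneous m)
    {x : PSpace K n} {v : Fin (n + 1) → K} (hv : v ∈ x.submodule) (h0 : v ≠ 0) :
    Vanishes f x ↔ eval v f = 0 := by
  refine ⟨fun h => h v hv, fun h w hw => ?_⟩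
  obtain ⟨t, rfl⟩ := (mem_submodule_iff hv h0).1 hw
  rw [eval_smul_of_isHomogeneous hf, h, mul_zero]

theorem Vanishes.add {f g : MvPolynomial (Fin (n + 1)) K} {x : PSpace K n} (hf : Vanishes f x)
    (hg : Vanishes g x) : Vanishes (f + g) x := fun v hv => by
  rw [map_add, hf v hv, hg v hv, add_zero]

theorem Vanishes.mul_left {g : MvPolynomial (Fin (n + 1)) K} {x : PSpace K n}
    (f : MvPolynomial (Fin (n + 1)) K) (hg : Vanishes g x) : Vanishes (f * g) x := fun v hv => by
  rw [map_mul, hg v hv, mul_zero]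

theorem vanishes_zero (x : PSpace K n) : Vanishes 0 x := fun v _ => by simp

/-- The ideal of all polynomials vanishing on `Y`. -/
def vanishingIdeal (Y : Set (PSpace K n)) : Ideal (MvPolynomial (Fin (n + 1)) K) where
  carrier := {f | ∀ x ∈ Y, Vanishes f x}
  add_mem' hf hg x hx := (hf x hx).add (hg x hx)
  zero_mem' x _ := vanishes_zero x
  smul_mem' f _ hg x hx := (hg x hx).mul_left f

theorem vanishingIdeal_anti {Y Z : Set (PSpace K n)} (h : Y ⊆ Z) :
    vanishingIdeal Z ≤ vanishingIdeal Y := fun _ hf x hx => hf x (h hx)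

theorem vanishes_of_mem_span {F : Set (MvPolynomial (Fin (n + 1)) K)} {x : PSpace K n}
    (hF : ∀ f ∈ F, Vanishes f x) {g : MvPolynomial (Fin (n + 1)) K} (hg : g ∈ Ideal.span F) :
    Vanishes g x := by
  have : Ideal.span F ≤ vanishingIdeal {x} := Ideal.span_le.2 fun f hf y hy => by
    rw [Set.mem_singleton_iff.1 hy]; exact hF f hf
  exact this hg x rfl

variable [Infinite K]

theorem vanishes_iff_restrictLine {f : MvPolynomial (Fin (n + 1)) K}
    {x : PSpace K n} {v : Fin (n + 1) → K} (hv : v ∈ x.submodule) (h0 : v ≠ 0) :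
    Vanishes f x ↔ restrictLine v f = 0 := by
  constructor
  · intro h
    refine Polynomial.funext fun t => ?_
    rw [eval_restrictLine, h _ (x.submodule.smul_mem t hv), Polynomial.eval_zero]
  · intro h w hw
    obtain ⟨t, rfl⟩ := (mem_submodule_iff hv h0).1 hw
    rw [← eval_restrictLine, h, Polynomial.eval_zero]

/-- No homogeneity is needed: restriction to the line is a ring map into the domain `K[X]`. -/
theorem vanishes_mul_iff {f g : MvPolynomial (Fin (n + 1)) K} {x : PSpace K n} :
    Vanishes (f * g) x ↔ Vanishes f x ∨ Vanishes g x := by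
  simp only [vanishes_iff_restrictLine (rep_mem_submodule x) x.rep_nonzero, map_mul, mul_eq_zero]

theorem restrictLine_of_isHomogeneous {σ : Type*} {f : MvPolynomial σ K} {m : ℕ}
    (hf : f.IsHomogeneous m) (v : σ → K) :
    restrictLine v f = Polynomial.C (eval v f) * Polynomial.X ^ m := by
  refine Polynomial.funext fun t => ?_
  rw [eval_restrictLine, eval_smul_of_isHomogeneous hf, mul_comm]
  simp

theorem coeff_restrictLine {σ : Type*} (f : MvPolynomial σ K) (v : σ → K) (m : ℕ) :
    (restrictLine v f).coeff m = eval v (homogeneousComponent m f) := by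
  conv_lhs => rw [← sum_homogeneousComponent f, map_sum]
  simp only [restrictLine_of_isHomogeneous (homogeneousComponent_isHomogeneous _ f) v,
    Polynomial.finsetSum_coeff, Polynomial.coeff_C_mul_X_pow]
  rw [Finset.sum_ite_eq]
  split_ifs with h
  · rfl
  · rw [homogeneousComponent_eq_zero _ _ (by simpa using h), map_zero]

/-- The values of the homogeneous components at a representative are the coefficients of the
restriction to the line, and `K` is infinite. This lets arbitrary polynomials define algebraic sets.
-/
theorem vanishes_iff_homogeneousComponent {f : MvPolynomial (Fin (n + 1)) K} {x : PSpace K n} :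
    Vanishes f x ↔ ∀ m, Vanishes (homogeneousComponent m f) x := by
  have hv := rep_mem_submodule x
  rw [vanishes_iff_restrictLine hv x.rep_nonzero, Polynomial.ext_iff]
  refine forall_congr' fun m => ?_
  rw [coeff_restrictLine, Polynomial.coeff_zero,
    vanishes_iff_eval (homogeneousComponent_isHomogeneous m f) hv x.rep_nonzero]

/-- A polynomial on the line that vanishes off the origin is killed by multiplication with `X`,
hence zero. Needed for Jacobian minors, whose homogeneity is not established. -/
theorem exists_ne_zero_eval_ne_zero {f : MvPolynomial (Fin (n + 1)) K} {x : PSpace K n}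
    (h : ¬ Vanishes f x) : ∃ v ∈ x.submodule, v ≠ 0 ∧ eval v f ≠ 0 := by
  by_contra! H
  have hv := rep_mem_submodule x
  refine h ((vanishes_iff_restrictLine hv x.rep_nonzero).2 ?_)
  refine (mul_eq_zero.1 (?_ : Polynomial.X * restrictLine x.rep f = 0)).resolve_left
    Polynomial.X_ne_zero
  refine Polynomial.funext fun t => ?_
  rw [Polynomial.eval_mul, Polynomial.eval_X, eval_restrictLine, Polynomial.eval_zero]
  rcases eq_or_ne t 0 with rfl | ht
  · simp
  · rw [H _ (x.submodule.smul_mem t hv) (smul_ne_zero ht x.rep_nonzero), mul_zero]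

/-! ### Algebraic sets and prime ideals -/

theorem isAlgebraicSet_zeroLocus (F : Set (MvPolynomial (Fin (n + 1)) K)) :
    IsAlgebraicSet {x : PSpace K n | ∀ f ∈ F, Vanishes f x} := by
  refine ⟨{g | ∃ f ∈ F, ∃ m, g = homogeneousComponent m f}, ?_, ?_⟩
  · rintro _ ⟨f, -, m, rfl⟩
    exact ⟨m, homogeneousComponent_isHomogeneous m f⟩
  · ext x
    simp only [Set.mem_ofPred_eq]
    constructor
    · rintro h _ ⟨f, hf, m, rfl⟩
      exact vanishes_iff_homogeneousComponent.1 (h f hf) m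
    · exact fun h f hf => vanishes_iff_homogeneousComponent.2 fun m => h _ ⟨f, hf, m, rfl⟩

omit [Infinite K] in
theorem IsAlgebraicSet.eq_zeroLocus {V : Set (PSpace K n)} (hV : IsAlgebraicSet V) :
    V = {x | ∀ f ∈ vanishingIdeal V, Vanishes f x} := by
  obtain ⟨F, -, rfl⟩ := hV
  ext x
  exact ⟨fun hx f hf => hf x hx, fun hx f hf => hx f fun y hy => hy f hf⟩

theorem IsIrreducibleSet.isPrime {Y : Set (PSpace K n)} (hY : IsIrreducibleSet Y) :
    (vanishingIdeal Y).IsPrime := by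
  obtain ⟨-, ⟨x, hx⟩, h⟩ := hY
  refine ⟨fun htop => ?_, fun {f g} hfg => ?_⟩
  · have h1 : (1 : MvPolynomial (Fin (n + 1)) K) ∈ vanishingIdeal Y := htop ▸ Submodule.mem_top
    simpa using h1 x hx _ (rep_mem_submodule x)
  · have key := h _ _ (isAlgebraicSet_zeroLocus {f}) (isAlgebraicSet_zeroLocus {g}) fun y hy => by
      simpa using vanishes_mul_iff.1 (hfg y hy)
    refine key.imp (fun H y hy => ?_) fun H y hy => ?_
    · simpa using H hy
    · simpa using H hy

omit [Infinite K] in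
theorem IsIrreducibleSet.vanishingIdeal_lt {Y Z : Set (PSpace K n)} (hY : IsIrreducibleSet Y)
    (h : Y ⊂ Z) : vanishingIdeal Z < vanishingIdeal Y := by
  refine lt_of_le_of_ne (vanishingIdeal_anti h.subset) fun heq => h.not_subset ?_
  intro x hx
  rw [hY.1.eq_zeroLocus]
  intro f hf
  rw [← heq] at hf
  exact hf x hx

/-- The irrelevant ideal: the polynomials vanishing at the origin. -/
noncomputable def irrelevantIdeal (K : Type*) [Field K] (n : ℕ) :
    Ideal (MvPolynomial (Fin (n + 1)) K) :=
  Ideal.span (Set.range X)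

omit [Infinite K] in
theorem irrelevantIdeal_eq_ker : irrelevantIdeal K n = RingHom.ker (constantCoeff (R := K)) := by
  rw [irrelevantIdeal]
  refine le_antisymm (Ideal.span_le.2 ?_) fun f hf => ?_
  · rintro _ ⟨i, rfl⟩
    simp
  · rw [RingHom.mem_ker] at hf
    rw [← Set.image_univ, mem_ideal_span_X_image]
    intro m hm
    by_contra! H
    have : m = 0 := Finsupp.ext fun i => H i (Set.mem_univ i)
    subst this
    exact (mem_support_iff.1 hm) hf

instance isPrime_irrelevantIdeal : (irrelevantIdeal K n).IsPrime := by
  rw [irrelevantIdeal_eq_ker]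
  exact RingHom.ker_isPrime _

omit [Infinite K] in
theorem height_irrelevantIdeal_le : (irrelevantIdeal K n).height ≤ (n + 1 : ℕ) := by
  classical
  have h := Ideal.height_le_card_of_mem_minimalPrimes_span_finset (p := irrelevantIdeal K n)
    (s := Finset.univ.image (X : Fin (n + 1) → MvPolynomial (Fin (n + 1)) K)) (by
      rw [Finset.coe_image, Finset.coe_univ, Set.image_univ]
      change irrelevantIdeal K n ∈ (irrelevantIdeal K n).minimalPrimes
      rw [Ideal.minimalPrimes_eq_subsingleton_self]
      rfl)
  refine h.trans ?_
  exact_mod_cast Finset.card_image_le.trans (by simp)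

omit [Infinite K] in
theorem vanishingIdeal_lt_irrelevantIdeal {Y : Set (PSpace K n)} (hY : Y.Nonempty) :
    vanishingIdeal Y < irrelevantIdeal K n := by
  obtain ⟨x, hx⟩ := hY
  refine lt_of_le_of_ne (fun f hf => ?_) fun heq => ?_
  · rw [irrelevantIdeal_eq_ker, RingHom.mem_ker, ← eval_zero]
    exact hf x hx 0 x.submodule.zero_mem
  · refine x.rep_nonzero (funext fun i => ?_)
    have : X i ∈ vanishingIdeal Y := heq ▸ Ideal.subset_span ⟨i, rfl⟩
    simpa using this x hx _ (rep_mem_submodule x)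

/-- The inclusion in the irrelevant ideal is strict; this strictness is what bounds projective
dimensions by `n` instead of the `n + 1` of the affine cone. -/
theorem IsIrreducibleSet.height_lt {Y : Set (PSpace K n)} (hY : IsIrreducibleSet Y) :
    (vanishingIdeal Y).height < (n + 1 : ℕ) := by
  have := hY.isPrime
  refine lt_of_lt_of_le ?_ (height_irrelevantIdeal_le (K := K) (n := n))
  exact Ideal.height_strict_mono_of_isPrime_of_isPrime (vanishingIdeal_lt_irrelevantIdeal hY.2.1)

theorem IsIrreducibleSet.height_add_one_le {Y Z : Set (PSpace K n)} (hY : IsIrreducibleSet Y)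
    (hZ : IsIrreducibleSet Z) (h : Y ⊂ Z) :
    (vanishingIdeal Z).height + 1 ≤ (vanishingIdeal Y).height := by
  have := hY.isPrime
  have := hZ.isPrime
  exact Ideal.height_add_one_le_of_lt_of_isPrime (hY.vanishingIdeal_lt h)

/-- The zero locus of the forms that belong to `P` is irreducible if `P` is prime for forms and
contains all forms vanishing on the locus. -/
theorem isIrreducibleSet_of_forms (P : Set (MvPolynomial (Fin (n + 1)) K))
    (Z : Set (PSpace K n)) (hZ : IsAlgebraicSet Z) (hne : Z.Nonempty)
    (hP : ∀ f m, f.IsHomogeneous m → (f ∈ P ↔ ∀ x ∈ Z, Vanishes f x))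
    (hprime : ∀ f g, f * g ∈ P → f ∈ P ∨ g ∈ P) : IsIrreducibleSet Z := by
  refine ⟨hZ, hne, fun A B ⟨F, hF, hA⟩ ⟨G, hG, hB⟩ hAB => ?_⟩
  by_contra! H
  obtain ⟨⟨a, haZ, haA⟩, ⟨b, hbZ, hbB⟩⟩ := And.intro (Set.not_subset.1 H.1) (Set.not_subset.1 H.2)
  rw [hA] at haA
  rw [hB] at hbB
  simp only [Set.mem_ofPred_eq, not_forall] at haA hbB
  obtain ⟨f, hfF, hfa⟩ := haA
  obtain ⟨g, hgG, hgb⟩ := hbB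
  obtain ⟨k, hk⟩ := hF f hfF
  obtain ⟨l, hl⟩ := hG g hgG
  have hfg : f * g ∈ P := (hP _ _ (hk.mul hl)).2 fun x hx => vanishes_mul_iff.2 <| by
    rcases hAB hx with h | h
    · left; rw [hA] at h; exact h f hfF
    · right; rw [hB] at h; exact h g hgG
  rcases hprime f g hfg with h | h
  · exact hfa ((hP _ _ hk).1 h a haZ)
  · exact hgb ((hP _ _ hl).1 h b hbZ)

/-- The closure of a point is irreducible, and among the irreducible subsets of `V` one whose
vanishing ideal has least height is maximal, because heights are finite and strictly monotone. -/
theorem exists_isComponent {V : Set (PSpace K n)} (hV : IsAlgebraicSet V) (hne : V.Nonempty) :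
    ∃ Z, IsComponent V Z := by
  obtain ⟨p, hp⟩ := hne
  let Z₀ : Set (PSpace K n) := {x | ∀ f ∈ vanishingIdeal {p}, Vanishes f x}
  have hpZ : p ∈ Z₀ := fun f hf => hf p rfl
  have hZ₀ : IsIrreducibleSet Z₀ ∧ Z₀ ⊆ V := by
    have hmin : ∀ A, IsAlgebraicSet A → p ∈ A → Z₀ ⊆ A := fun A hA hpA x hx => by
      rw [hA.eq_zeroLocus]
      exact fun f hf => hx f (vanishingIdeal_anti (by simpa using hpA) hf)
    exact ⟨⟨isAlgebraicSet_zeroLocus _, ⟨p, hpZ⟩, fun A B hA hB h =>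
      (h hpZ).imp (hmin A hA) (hmin B hB)⟩, hmin V hV hp⟩
  let S : Set (Set (PSpace K n)) := {Y | IsIrreducibleSet Y ∧ Y ⊆ V}
  obtain ⟨Z, hZ, hmin⟩ := (InvImage.wf (fun Y : Set (PSpace K n) => (vanishingIdeal Y).height)
    (wellFounded_lt (α := ℕ∞))).has_min S ⟨Z₀, hZ₀⟩
  refine ⟨Z, hZ, fun Y hY hle => ?_⟩
  by_contra hlt
  refine hmin Y hY ?_
  have h1 := hZ.1.height_add_one_le hY.1 ⟨hle, hlt⟩
  have h2 := hY.1.height_lt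
  exact (ENat.add_one_le_iff (ne_top_of_lt h2)).1 h1

end Lines

/-! ### Linear functionals -/

section Functionals

variable {K V ι : Type*} [Field K] [AddCommGroup V] [Module K V] [Fintype ι]

/-- A functional that kills the range of the joint map of the `D j` is a linear relation between
them, so this map is onto. -/
theorem exists_dual_family [DecidableEq ι] {D : ι → Module.Dual K V} (hD : LinearIndependent K D) :
    ∃ w : ι → V, ∀ j k, D j (w k) = if k = j then 1 else 0 := by
  have hsurj : LinearMap.range (LinearMap.pi D) = ⊤ := by
    by_contra h
    obtain ⟨c, hc0, hc⟩ := Submodule.exists_le_ker_of_lt_top _ (lt_top_iff_ne_top.2 h)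
    refine hc0 ?_
    have hsum : ∑ j, c (Pi.single j 1) • D j = 0 := by
      ext v
      have hv : c (LinearMap.pi D v) = 0 := hc ⟨v, rfl⟩
      rw [LinearMap.pi_apply_eq_sum_univ c] at hv
      have hsingle (i : ι) : (fun j => if i = j then (1 : K) else 0) = Pi.single i 1 := by
        ext j
        simp [Pi.single_apply, eq_comm]
      simpa [mul_comm, hsingle] using hv
    have h0 := Fintype.linearIndependent_iff.1 hD _ hsum
    refine LinearMap.pi_ext' fun j => ?_
    ext
    simpa using h0 j
  choose w hw using LinearMap.range_eq_top.1 hsurj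
  refine ⟨fun k => w (Pi.single k 1), fun j k => ?_⟩
  have := congrFun (hw (Pi.single k 1)) j
  simpa [Pi.single_apply, eq_comm] using this

theorem linearIndependent_of_det_ne_zero [DecidableEq ι] {D : ι → Module.Dual K V} {w : ι → V}
    (h : (Matrix.of fun j k => D j (w k)).det ≠ 0) : LinearIndependent K D := by
  refine Fintype.linearIndependent_iff.2 fun c hc => ?_
  have hz : Matrix.vecMul c (Matrix.of fun j k => D j (w k)) = 0 := by
    ext k
    simpa [Matrix.vecMul, dotProduct] using LinearMap.congr_fun hc (w k)
  exact congrFun (Matrix.eq_zero_of_vecMul_eq_zero h hz)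

theorem finrank_dualCoannihilator_span_add_iff [FiniteDimensional K V] (D : ι → Module.Dual K V) :
    Module.finrank K (Submodule.span K (Set.range D)).dualCoannihilator + Fintype.card ι =
      Module.finrank K V ↔ LinearIndependent K D := by
  rw [linearIndependent_iff_card_eq_finrank_span, Set.finrank,
    ← Subspace.finrank_add_finrank_dualCoannihilator_eq (Submodule.span K (Set.range D))]
  omega

end Functionals

/-! ### Differentials -/

section Differential

variable {K : Type*} [Field K] {n : ℕ}

theorem differential_apply (f : MvPolynomial (Fin (n + 1)) K) (v w : Fin (n + 1) → K) :
    differential f v w = ∑ i, eval v (pderiv i f) * w i := by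
  simp [differential]

/-- The differential at `v` as a linear function of the polynomial. -/
noncomputable def differentialHom (v : Fin (n + 1) → K) :
    MvPolynomial (Fin (n + 1)) K →ₗ[K] Module.Dual K (Fin (n + 1) → K) where
  toFun f := differential f v
  map_add' f g := by
    ext i
    simp [differential_apply, add_mul, Finset.sum_add_distrib]
  map_smul' c f := by
    ext i
    simp [differential_apply, Finset.mul_sum, smul_eval, mul_assoc]

theorem differential_mul (f g : MvPolynomial (Fin (n + 1)) K) (v : Fin (n + 1) → K) :
    differential (f * g) v = eval v f • differential g v + eval v g • differential f v := by
  ext i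
  simp only [LinearMap.comp_apply, LinearMap.add_apply, LinearMap.smul_apply, differential_apply,
    Derivation.leibniz, smul_eq_mul, Finset.mul_sum]
  rw [← Finset.sum_add_distrib]
  refine Finset.sum_congr rfl fun j _ => ?_
  simp only [map_add, map_mul]
  ring

theorem differential_self {f : MvPolynomial (Fin (n + 1)) K} {m : ℕ} (hf : f.IsHomogeneous m)
    (v : Fin (n + 1) → K) : differential f v v = m * eval v f := by
  rw [differential_apply]
  have := congrArg (eval v) hf.sum_X_mul_pderiv
  simpa [mul_comm] using this

theorem differential_smul {f : MvPolynomial (Fin (n + 1)) K} {m : ℕ} (hf : f.IsHomogeneous m)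
    (t : K) (v : Fin (n + 1) → K) :
    differential f (t • v) = t ^ (m - 1) • differential f v := by
  ext i
  simp only [LinearMap.comp_apply, LinearMap.smul_apply, differential_apply, smul_eq_mul,
    Finset.mul_sum]
  refine Finset.sum_congr rfl fun j _ => ?_
  rw [eval_smul_of_isHomogeneous hf.pderiv, mul_assoc]

/-- The Jacobian minor of the polynomials `f` along the vectors `w`. -/
noncomputable def jacobianMinor {s : ℕ} (f : Fin s → MvPolynomial (Fin (n + 1)) K)
    (w : Fin s → Fin (n + 1) → K) : MvPolynomial (Fin (n + 1)) K :=
  (Matrix.of fun j k => ∑ i, pderiv i (f j) * C (w k i)).det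

theorem eval_jacobianMinor {s : ℕ} (f : Fin s → MvPolynomial (Fin (n + 1)) K)
    (w : Fin s → Fin (n + 1) → K) (v : Fin (n + 1) → K) :
    eval v (jacobianMinor f w) = (Matrix.of fun j k => differential (f j) v (w k)).det := by
  rw [jacobianMinor, RingHom.map_det]
  congr 1
  ext j k
  simp [differential_apply]

/-! ### Tangent spaces -/

theorem finrank_tangent (x : PSpace K n) : Module.finrank K (Tangent x) = n := by
  rw [Module.finrank_linearMap, x.finrank_submodule, one_mul]
  have := Submodule.finrank_quotient_add_finrank x.submodule
  rw [x.finrank_submodule, Module.finrank_fin_fun] at this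
  omega

theorem exists_lift (x : PSpace K n) :
    ∃ σ : ((Fin (n + 1) → K) ⧸ x.submodule) →ₗ[K] (Fin (n + 1) → K),
      x.submodule.mkQ ∘ₗ σ = LinearMap.id :=
  LinearMap.exists_rightInverse_of_surjective _ (Submodule.range_mkQ _)

/-- The linear map `T_x ℙⁿ → K^(n+1)` lifting the evaluation at the chosen representative of `x`. -/
noncomputable def tangentLift (x : PSpace K n) : Tangent x →ₗ[K] (Fin (n + 1) → K) :=
  (exists_lift x).choose ∘ₗ LinearMap.applyₗ (⟨x.rep, rep_mem_submodule x⟩ : x.submodule)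

theorem mkQ_tangentLift (x : PSpace K n) (φ : Tangent x) :
    x.submodule.mkQ (tangentLift x φ) = φ ⟨x.rep, rep_mem_submodule x⟩ :=
  LinearMap.congr_fun (exists_lift x).choose_spec _

/-- The differential of a polynomial as a functional on `T_x ℙⁿ`; it is meaningful for forms that
vanish at `x`. -/
noncomputable def tangentDifferential (x : PSpace K n) :
    MvPolynomial (Fin (n + 1)) K →ₗ[K] Module.Dual K (Tangent x) :=
  (tangentLift x).dualMap ∘ₗ differentialHom x.rep

theorem tangentDifferential_apply (x : PSpace K n) (f : MvPolynomial (Fin (n + 1)) K)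
    (φ : Tangent x) :
    tangentDifferential x f φ = differential f x.rep (tangentLift x φ) := rfl

theorem tangentDifferential_mul {x : PSpace K n} (f : MvPolynomial (Fin (n + 1)) K)
    {g : MvPolynomial (Fin (n + 1)) K} (hg : Vanishes g x) :
    tangentDifferential x (f * g) = eval x.rep f • tangentDifferential x g := by
  ext φ
  simp [tangentDifferential_apply, differential_mul, hg _ (rep_mem_submodule x)]

/-- By Euler's identity the differential kills the line `x`, so the choice of lift is irrelevant. -/
theorem differential_rep_eq {f : MvPolynomial (Fin (n + 1)) K} {m : ℕ} (hf : f.IsHomogeneous m)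
    {x : PSpace K n} (hx : Vanishes f x) {w w' : Fin (n + 1) → K}
    (h : x.submodule.mkQ w = x.submodule.mkQ w') :
    differential f x.rep w = differential f x.rep w' := by
  rw [Submodule.mkQ_apply, Submodule.mkQ_apply, Submodule.Quotient.eq,
    mem_submodule_iff (rep_mem_submodule x) x.rep_nonzero] at h
  obtain ⟨t, ht⟩ := h
  rw [← sub_eq_zero, ← map_sub, ← ht, map_smul, differential_self hf,
    hx _ (rep_mem_submodule x), mul_zero, smul_zero]

/-- Rescaling the representative only multiplies the differential of a form by a scalar, so the
condition needs checking at `x.rep` alone. -/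
theorem mem_tangentCut_iff {F : Set (MvPolynomial (Fin (n + 1)) K)} {x : PSpace K n}
    (hF : ∀ f ∈ F, (∃ m, f.IsHomogeneous m) ∧ Vanishes f x) (φ : Tangent x) :
    φ ∈ tangentCut F x ↔ ∀ f ∈ F, tangentDifferential x f φ = 0 := by
  simp only [tangentCut, Submodule.mem_iInf, Submodule.mem_comap, Submodule.mem_map,
    LinearMap.mem_ker]
  constructor
  · intro h f hf
    obtain ⟨w, hw, hφ⟩ := h ⟨x.rep, rep_mem_submodule x⟩
    obtain ⟨⟨m, hm⟩, hx⟩ := hF f hf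
    rw [tangentDifferential_apply, ← hw f hf]
    exact differential_rep_eq hm hx ((mkQ_tangentLift x φ).trans hφ.symm)
  · rintro h ⟨v, hv⟩
    obtain ⟨t, rfl⟩ := (mem_submodule_iff (rep_mem_submodule x) x.rep_nonzero).1 hv
    refine ⟨t • tangentLift x φ, fun f hf => ?_, ?_⟩
    · obtain ⟨⟨m, hm⟩, hx⟩ := hF f hf
      have := h f hf
      rw [tangentDifferential_apply] at this
      rw [differential_smul hm, LinearMap.smul_apply, map_smul, this, smul_zero, smul_zero]
    · rw [map_smul, mkQ_tangentLift, ← map_smul]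
      rfl

theorem iInf_tangentCut_eq {s : ℕ} {f : Fin s → MvPolynomial (Fin (n + 1)) K} {x : PSpace K n}
    (hf : ∀ j, (∃ m, (f j).IsHomogeneous m) ∧ Vanishes (f j) x) :
    ⨅ j, tangentCut {f j} x =
      (Submodule.span K (Set.range fun j => tangentDifferential x (f j))).dualCoannihilator := by
  ext φ
  rw [Submodule.mem_iInf, ← SetLike.mem_coe, Submodule.coe_dualCoannihilator_span]
  simp only [Set.forall_mem_range, Set.mem_ofPred_eq]
  refine forall_congr' fun j => ?_
  rw [mem_tangentCut_iff (by simpa using hf j)]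
  simp

theorem finrank_iInf_tangentCut_iff {s : ℕ} {f : Fin s → MvPolynomial (Fin (n + 1)) K}
    {x : PSpace K n} (hf : ∀ j, (∃ m, (f j).IsHomogeneous m) ∧ Vanishes (f j) x) :
    Module.finrank K ↥(⨅ j, tangentCut {f j} x) + s = n ↔
      LinearIndependent K fun j => tangentDifferential x (f j) := by
  rw [iInf_tangentCut_eq hf, ← finrank_dualCoannihilator_span_add_iff, finrank_tangent,
    Fintype.card_fin]

theorem exists_tangent_apply_eq (x : PSpace K n) (u : (Fin (n + 1) → K) ⧸ x.submodule) :
    ∃ φ : Tangent x, φ ⟨x.rep, rep_mem_submodule x⟩ = u := by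
  obtain ⟨ψ, hψ⟩ : ∃ ψ : Module.Dual K x.submodule, ψ ⟨x.rep, rep_mem_submodule x⟩ ≠ 0 := by
    by_contra! h
    exact x.rep_nonzero (congrArg Subtype.val ((Module.forall_dual_apply_eq_zero_iff K _).1 h))
  exact ⟨ψ.smulRight ((ψ ⟨x.rep, rep_mem_submodule x⟩)⁻¹ • u), by
    rw [LinearMap.smulRight_apply, smul_smul, mul_inv_cancel₀ hψ, one_smul]⟩

/-- Every class modulo the line is the value of some tangent vector at `x.rep`, so no relation is
gained by passing from the ambient space to the tangent space. -/
theorem linearIndependent_tangentDifferential_iff {ι : Type*} [Fintype ι]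
    {f : ι → MvPolynomial (Fin (n + 1)) K} {x : PSpace K n}
    (hf : ∀ j, (∃ m, (f j).IsHomogeneous m) ∧ Vanishes (f j) x) :
    (LinearIndependent K fun j => tangentDifferential x (f j)) ↔
      LinearIndependent K fun j => differential (f j) x.rep := by
  constructor
  · exact fun h => LinearIndependent.of_comp (tangentLift x).dualMap h
  · intro h
    refine Fintype.linearIndependent_iff.2 fun c hc => Fintype.linearIndependent_iff.1 h c ?_
    refine LinearMap.ext fun w => ?_
    obtain ⟨φ, hφ⟩ := exists_tangent_apply_eq x (x.submodule.mkQ w)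
    have hφc := LinearMap.congr_fun hc φ
    simp only [LinearMap.sum_apply, LinearMap.smul_apply, LinearMap.zero_apply,
      tangentDifferential_apply] at hφc ⊢
    rw [← hφc]
    refine Finset.sum_congr rfl fun j _ => ?_
    obtain ⟨⟨m, hm⟩, hx⟩ := hf j
    rw [differential_rep_eq hm hx ((mkQ_tangentLift x φ).trans hφ).symm]

end Differential

/-! ### Forms vanishing at the nodes of a grid -/

section Grid

variable {K : Type*} [Field K] {n d : ℕ}

/-- The linear form attached to a functional. -/
noncomputable def linearForm :
    Module.Dual K (Fin (n + 1) → K) →ₗ[K] MvPolynomial (Fin (n + 1)) K where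
  toFun φ := ∑ i, C (φ (Pi.single i 1)) * X i
  map_add' φ ψ := by simp [add_mul, Finset.sum_add_distrib]
  map_smul' c φ := by simp [Finset.smul_sum, C_mul', smul_smul]

theorem linearForm_apply (φ : Module.Dual K (Fin (n + 1) → K)) :
    linearForm φ = ∑ i, C (φ (Pi.single i 1)) * X i := rfl

theorem eval_linearForm (φ : Module.Dual K (Fin (n + 1) → K)) (v : Fin (n + 1) → K) :
    eval v (linearForm φ) = φ v := by
  have h := LinearMap.pi_apply_eq_sum_univ φ v
  have hsingle (i : Fin (n + 1)) :
      (fun j => if i = j then (1 : K) else 0) = Pi.single i 1 := by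
    ext j
    simp [Pi.single_apply, eq_comm]
  rw [h, linearForm_apply]
  simp [hsingle, mul_comm]

theorem isHomogeneous_linearForm (φ : Module.Dual K (Fin (n + 1) → K)) :
    (linearForm φ).IsHomogeneous 1 :=
  IsHomogeneous.sum _ _ _ fun _ _ => isHomogeneous_C_mul_X _ _

theorem differential_linearForm (φ : Module.Dual K (Fin (n + 1) → K)) (v : Fin (n + 1) → K) :
    differential (linearForm φ) v = φ := by
  ext i
  simp [differential_apply, linearForm_apply, pderiv_X, Pi.single_apply]

theorem X_eq_linearForm (i : Fin (n + 1)) :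
    (X i : MvPolynomial (Fin (n + 1)) K) = linearForm (LinearMap.proj i) := by
  simp [linearForm_apply, Pi.single_apply]

/-- The product of the linear forms of one color. -/
noncomputable def colorForm (φ : Fin n → Fin d → Module.Dual K (Fin (n + 1) → K)) (j : Fin n) :
    MvPolynomial (Fin (n + 1)) K :=
  ∏ i, linearForm (φ j i)

theorem isHomogeneous_colorForm (φ : Fin n → Fin d → Module.Dual K (Fin (n + 1) → K)) (j : Fin n) :
    (colorForm φ j).IsHomogeneous d := by
  have := IsHomogeneous.prod Finset.univ (fun i => linearForm (φ j i)) (fun _ => 1)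
    fun i _ => isHomogeneous_linearForm _
  simpa [colorForm] using this

/-- The Newton form with multi-index `a`: the product of the first `a j` linear forms of each
color `j`. -/
noncomputable def newtonForm (φ : Fin n → Fin d → Module.Dual K (Fin (n + 1) → K))
    (a : Fin n → Fin d) : MvPolynomial (Fin (n + 1)) K :=
  ∏ j, ∏ i ∈ Finset.Iio (a j), linearForm (φ j i)

/-- A form of degree `m` is, modulo the color forms, a combination of Newton forms. -/
theorem mem_span_newtonForm (φ : Fin n → Fin d → Module.Dual K (Fin (n + 1) → K))
    (ψ : Module.Dual K (Fin (n + 1) → K))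
    (hspan : ∀ c : Fin n → Fin d, Submodule.span K (insert ψ (Set.range fun j => φ j (c j))) = ⊤)
    (c₀ : Fin n → Fin d) {m : ℕ}
    {h : MvPolynomial (Fin (n + 1)) K} (hh : h.IsHomogeneous m) :
    h ∈ Submodule.span K (Set.range fun a : {a : Fin n → Fin d // ∑ j, (a j : ℕ) ≤ m} =>
        newtonForm φ a * linearForm ψ ^ (m - ∑ j, (a.1 j : ℕ))) ⊔
      (Ideal.span (Set.range (colorForm φ))).restrictScalars K := by
  induction m generalizing h with
  | zero =>
    rw [← mem_homogeneousSubmodule, homogeneousSubmodule_zero, Submodule.mem_one] at hh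
    obtain ⟨r, rfl⟩ := hh
    refine Submodule.mem_sup_left ?_
    -- `c₀` only certifies that the index 0 exists in each color.
    let a : Fin n → Fin d := fun j => ⟨0, (c₀ j).pos⟩
    rw [Algebra.algebraMap_eq_smul_one]
    refine Submodule.smul_mem _ _ (Submodule.subset_span ⟨⟨a, by simp [a]⟩, ?_⟩)
    have : ∀ j, Finset.Iio (a j) = ∅ := fun j => by
      ext i; simp [a, Fin.lt_def]
    simp [newtonForm, this]
  | succ m ih =>
    rw [← mem_homogeneousSubmodule, ← homogeneousSubmodule_one_pow, pow_succ,
      homogeneousSubmodule_one_pow, homogeneousSubmodule_one_eq_span_X] at hh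
    induction hh using Submodule.mul_induction_on' with
    | add x _ y _ hx hy => exact Submodule.add_mem _ hx hy
    | mem_mul_mem g hg x hx =>
    have hx' : ∃ θ, x = linearForm θ := by
      have : Submodule.span K (Set.range (X : Fin (n + 1) → MvPolynomial (Fin (n + 1)) K)) ≤
          LinearMap.range linearForm := Submodule.span_le.2 <| by
        rintro _ ⟨i, rfl⟩
        exact ⟨_, (X_eq_linearForm i).symm⟩
      obtain ⟨θ, rfl⟩ := this hx
      exact ⟨θ, rfl⟩
    obtain ⟨θ, rfl⟩ := hx'
    clear hx
    have hgm := ih ((mem_homogeneousSubmodule _ _).1 hg)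
    obtain ⟨g₁, hg₁, g₂, hg₂, rfl⟩ := Submodule.mem_sup.1 hgm
    rw [add_mul]
    refine Submodule.add_mem _ ?_ (Submodule.mem_sup_right (Ideal.mul_mem_right _ _ hg₂))
    clear hg hgm hg₂
    induction hg₁ using Submodule.span_induction with
    | zero => simp
    | add p q _ _ hp hq => rw [add_mul]; exact Submodule.add_mem _ hp hq
    | smul r p _ hp => rw [smul_mul_assoc]; exact Submodule.smul_mem _ _ hp
    | mem p hp =>
    obtain ⟨⟨a, ha⟩, rfl⟩ := hp
    -- Expand the new linear factor in the spanning set adapted to `a`. The factor `ψ` raises the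
    -- power of `ψ`; the factor `φ j (a j)` raises `a j` by one or, when `a j = d - 1`, completes
    -- the color form `j`.
    have hθ : θ ∈ Submodule.span K (insert ψ (Set.range fun j => φ j (a j))) :=
      hspan a ▸ Submodule.mem_top
    dsimp only at *
    induction hθ using Submodule.span_induction with
    | zero => simp
    | add p q _ _ hp hq => rw [map_add, mul_add]; exact Submodule.add_mem _ hp hq
    | smul r p _ hp => rw [map_smul, mul_smul_comm]; exact Submodule.smul_mem _ _ hp
    | mem θ hθ =>
    rcases hθ with rfl | ⟨j, rfl⟩
    · refine Submodule.mem_sup_left (Submodule.subset_span ⟨⟨a, by omega⟩, ?_⟩)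
      dsimp only
      rw [Nat.succ_sub ha, pow_succ, mul_assoc]
    · dsimp only
      have hprod : newtonForm φ a * linearForm (φ j (a j)) =
          (∏ i ∈ Finset.Iic (a j), linearForm (φ j i)) *
            ∏ k ∈ Finset.univ.erase j, ∏ i ∈ Finset.Iio (a k), linearForm (φ k i) := by
        rw [newtonForm, ← Finset.mul_prod_erase _ _ (Finset.mem_univ j), ← Finset.Iio_insert,
          Finset.prod_insert (by simp)]
        ring
      by_cases hlt : (a j : ℕ) + 1 < d
      · let b : Fin n → Fin d := Function.update a j ⟨a j + 1, hlt⟩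
        have hb : newtonForm φ b = newtonForm φ a * linearForm (φ j (a j)) := by
          rw [hprod, newtonForm, ← Finset.mul_prod_erase _ _ (Finset.mem_univ j)]
          congr 1
          · refine Finset.prod_congr ?_ fun _ _ => rfl
            ext i
            rw [Finset.mem_Iio, Finset.mem_Iic, Fin.lt_def, Fin.le_def]
            simp only [b, Function.update_self]
            omega
          · refine Finset.prod_congr rfl fun k hk => ?_
            rw [Finset.mem_erase] at hk
            simp [b, hk.1]
        have hsum : ∑ k, (b k : ℕ) = ∑ k, (a k : ℕ) + 1 := by
          rw [← Finset.add_sum_erase _ _ (Finset.mem_univ j),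
            ← Finset.add_sum_erase _ (fun k => (a k : ℕ)) (Finset.mem_univ j)]
          have : ∑ k ∈ Finset.univ.erase j, (b k : ℕ) = ∑ k ∈ Finset.univ.erase j, (a k : ℕ) :=
            Finset.sum_congr rfl fun k hk => by
              rw [Finset.mem_erase] at hk
              simp [b, hk.1]
          rw [this]
          simp [b]
          omega
        refine Submodule.mem_sup_left (Submodule.subset_span ⟨⟨b, by omega⟩, ?_⟩)
        dsimp only
        rw [hb, hsum, Nat.add_sub_add_right]
        ring
      · refine Submodule.mem_sup_right ?_
        have huniv : Finset.Iic (a j) = Finset.univ := by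
          ext i
          simp only [Finset.mem_Iic, Finset.mem_univ, iff_true]
          rw [Fin.le_def]
          omega
        rw [mul_right_comm, hprod, huniv, Submodule.restrictScalars_mem, mul_assoc]
        exact Ideal.mul_mem_right _ _ (Ideal.subset_span ⟨j, rfl⟩)

/-- Interpolation on a simplicial set of nodes: a form of degree `m` which vanishes at the nodes
with multi-indices of sum at most `m` lies in the ideal of the color forms. -/
theorem mem_span_colorForm (φ : Fin n → Fin d → Module.Dual K (Fin (n + 1) → K))
    (ψ : Module.Dual K (Fin (n + 1) → K))
    (hspan : ∀ c : Fin n → Fin d, Submodule.span K (insert ψ (Set.range fun j => φ j (c j))) = ⊤)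
    (c₀ : Fin n → Fin d) (v : (Fin n → Fin d) → Fin (n + 1) → K)
    (hψ : ∀ c, ψ (v c) ≠ 0) (hφ : ∀ c j i, φ j i (v c) = 0 ↔ i = c j) {m : ℕ}
    {h : MvPolynomial (Fin (n + 1)) K} (hh : h.IsHomogeneous m)
    (hv : ∀ c : Fin n → Fin d, ∑ j, (c j : ℕ) ≤ m → eval (v c) h = 0) :
    h ∈ Ideal.span (Set.range (colorForm φ)) := by
  obtain ⟨g, hg, r, hr, rfl⟩ := Submodule.mem_sup.1 (mem_span_newtonForm φ ψ hspan c₀ hh)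
  refine Ideal.add_mem _ ?_ hr
  obtain ⟨κ, rfl⟩ := (Submodule.mem_span_range_iff_exists_fun K).1 hg
  have hr0 (c : Fin n → Fin d) : eval (v c) r = 0 := by
    have : Ideal.span (Set.range (colorForm φ)) ≤ RingHom.ker (eval (v c)) := by
      refine Ideal.span_le.2 ?_
      rintro _ ⟨j, rfl⟩
      rw [SetLike.mem_coe, RingHom.mem_ker, colorForm, map_prod]
      exact Finset.prod_eq_zero (Finset.mem_univ (c j)) (by rw [eval_linearForm, hφ])
    exact this hr
  have hN (c a : Fin n → Fin d) (hne : eval (v c) (newtonForm φ a) ≠ 0) : ∀ j, a j ≤ c j := by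
    intro j
    by_contra! hlt
    refine hne ?_
    rw [newtonForm, map_prod]
    refine Finset.prod_eq_zero (Finset.mem_univ j) ?_
    rw [map_prod]
    exact Finset.prod_eq_zero (Finset.mem_Iio.2 hlt) (by rw [eval_linearForm, hφ])
  have hN0 (c : Fin n → Fin d) : eval (v c) (newtonForm φ c) ≠ 0 := by
    rw [newtonForm, map_prod]
    refine Finset.prod_ne_zero_iff.2 fun j _ => ?_
    rw [map_prod]
    refine Finset.prod_ne_zero_iff.2 fun i hi => ?_
    rw [eval_linearForm, Ne, hφ]
    exact (Finset.mem_Iio.1 hi).ne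
  -- The Newton form of `b` is nonzero at the node `a` only if `b ≤ a` in every color: the system is
  -- triangular, and the coefficients die by induction on the index sum.
  have hκ : ∀ N : ℕ, ∀ a : {a : Fin n → Fin d // ∑ j, (a j : ℕ) ≤ m},
      ∑ j, (a.1 j : ℕ) = N → κ a = 0 := by
    intro N
    induction N using Nat.strong_induction_on with
    | _ N ih =>
    intro a ha
    have h0 := hv a.1 a.2
    rw [map_add, hr0, add_zero, map_sum, Finset.sum_eq_single a] at h0
    · rw [smul_eval, map_mul, map_pow, eval_linearForm] at h0
      exact (mul_eq_zero.1 h0).resolve_right (mul_ne_zero (hN0 _) (pow_ne_zero _ (hψ _)))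
    · intro b _ hb
      rw [smul_eval, map_mul]
      by_cases hz : eval (v a.1) (newtonForm φ b.1) = 0
      · rw [hz, zero_mul, mul_zero]
      · have hle := hN _ _ hz
        have hlt : ∑ j, (b.1 j : ℕ) < ∑ j, (a.1 j : ℕ) := by
          refine Finset.sum_lt_sum (fun j _ => hle j) ?_
          by_contra! H
          exact hb (Subtype.ext (funext fun j =>
            le_antisymm (hle j) (Fin.le_def.2 (H j (Finset.mem_univ j)))))
        rw [ih _ (ha ▸ hlt) b rfl, zero_mul]
    · simp
  rw [Finset.sum_eq_zero fun a _ => by rw [hκ _ a rfl, zero_smul]]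
  exact Ideal.zero_mem _

end Grid

end CageVarieties

namespace CageVarieties

open MvPolynomial Filter Topology

/-! ### Germs of transverse intersections -/

section Germ

variable {𝕜 : Type*} [RCLike 𝕜]

/-- Analytic germs form a domain: if `f` is nonzero at a point of a small ball, then `g` vanishes
near that point, hence on the whole ball by the identity theorem. -/
theorem eventually_eq_zero_of_mul {E : Type*} [NormedAddCommGroup E] [NormedSpace 𝕜 E]
    {f g : E → 𝕜} {z : E} (hf : AnalyticAt 𝕜 f z) (hg : AnalyticAt 𝕜 g z)
    (hfg : ∀ᶠ y in 𝓝 z, f y * g y = 0) : (∀ᶠ y in 𝓝 z, f y = 0) ∨ ∀ᶠ y in 𝓝 z, g y = 0 := by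
  -- Convexity of balls, used for connectedness, is a real notion.
  let _ : NormedSpace ℝ E := NormedSpace.restrictScalars ℝ 𝕜 E
  obtain ⟨r, hr, hball⟩ := Metric.eventually_nhds_iff_ball.1
    ((hf.eventually_analyticAt.and hg.eventually_analyticAt).and hfg)
  by_cases h : ∃ y ∈ Metric.ball z r, f y ≠ 0
  · right
    obtain ⟨y, hy, hfy⟩ := h
    have hg0 : g =ᶠ[𝓝 y] 0 := by
      filter_upwards [(hball y hy).1.1.continuousAt.eventually_ne hfy,
        Metric.isOpen_ball.mem_nhds hy] with u hu hub
      exact (mul_eq_zero.1 (hball u hub).2).resolve_left hu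
    have hon : AnalyticOnNhd 𝕜 g (Metric.ball z r) := fun u hu => (hball u hu).1.2
    have key := hon.eqOn_zero_of_preconnected_of_eventuallyEq_zero
      (convex_ball z r).isPreconnected hy hg0
    filter_upwards [Metric.ball_mem_nhds z hr] with u hu using key hu
  · left
    push Not at h
    filter_upwards [Metric.ball_mem_nhds z hr] with u hu using h u hu

theorem hasFDerivAt_eval {n : ℕ} (f : MvPolynomial (Fin (n + 1)) 𝕜) (v : Fin (n + 1) → 𝕜) :
    HasFDerivAt (fun w => eval w f) (differential f v).toContinuousLinearMap v := by
  induction f using MvPolynomial.induction_on with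
  | C a =>
    have : (differential (C a) v).toContinuousLinearMap = 0 := by
      ext w; simp [differential_apply]
    rw [this]
    simpa using hasFDerivAt_const a v
  | add p q hp hq =>
    have : (differential (p + q) v).toContinuousLinearMap =
        (differential p v).toContinuousLinearMap + (differential q v).toContinuousLinearMap := by
      ext w; simp [differential_apply, add_mul, Finset.sum_add_distrib]
    rw [this]
    simpa using hp.fun_add hq
  | mul_X p i hp =>
    have h := hp.mul (hasFDerivAt_apply (𝕜 := 𝕜) i v)
    have : (differential (p * X i) v).toContinuousLinearMap =
        eval v p • ContinuousLinearMap.proj i + v i • (differential p v).toContinuousLinearMap := by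
      ext w
      simp [differential_mul, differential_apply (X i), pderiv_X, Pi.single_apply]
    rw [this]
    simpa using! h

variable {n : ℕ} (f : Fin n → MvPolynomial (Fin (n + 1)) 𝕜) (k : ℕ) (v : Fin (n + 1) → 𝕜)

/-- The polynomials vanishing near `v` on the common zero set of the first `k` members of `f`. -/
def germIdeal : Ideal (MvPolynomial (Fin (n + 1)) 𝕜) where
  carrier := {h | ∀ᶠ w in 𝓝 v, (∀ i : Fin n, (i : ℕ) < k → eval w (f i) = 0) → eval w h = 0}
  add_mem' hf hg := by
    filter_upwards [hf, hg] with w h1 h2 h3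
    rw [map_add, h1 h3, h2 h3, add_zero]
  zero_mem' := by simp
  smul_mem' c g hg := by
    filter_upwards [hg] with w h1 h3
    rw [smul_eq_mul, map_mul, h1 h3, mul_zero]

variable {f k v}

theorem mem_germIdeal {h : MvPolynomial (Fin (n + 1)) 𝕜} : h ∈ germIdeal f k v ↔
    ∀ᶠ w in 𝓝 v, (∀ i : Fin n, (i : ℕ) < k → eval w (f i) = 0) → eval w h = 0 := Iff.rfl

theorem mem_germIdeal_of_lt {i : Fin n} (hi : (i : ℕ) < k) : f i ∈ germIdeal f k v :=
  Eventually.of_forall fun _ h => h i hi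

theorem germIdeal_mono {l : ℕ} (h : k ≤ l) : germIdeal f k v ≤ germIdeal f l v := fun g hg => by
  rw [mem_germIdeal] at hg ⊢
  filter_upwards [hg] with w hw H using hw fun i hi => H i (hi.trans_le h)

theorem eval_eq_zero_of_mem_germIdeal (hv : ∀ i, eval v (f i) = 0)
    {h : MvPolynomial (Fin (n + 1)) 𝕜} (hh : h ∈ germIdeal f k v) : eval v h = 0 :=
  (mem_germIdeal.1 hh).self_of_nhds fun i _ => hv i

/-- The projection killing the first `k` coordinates. -/
noncomputable def killFirst (𝕜 : Type*) [RCLike 𝕜] (n k : ℕ) :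
    ((Fin n → 𝕜) × 𝕜) →L[𝕜] ((Fin n → 𝕜) × 𝕜) :=
  (ContinuousLinearMap.pi fun i : Fin n =>
    if (i : ℕ) < k then 0 else ContinuousLinearMap.proj i).prodMap (ContinuousLinearMap.id 𝕜 𝕜)

theorem killFirst_fst (y : (Fin n → 𝕜) × 𝕜) (i : Fin n) :
    (killFirst 𝕜 n k y).1 i = if (i : ℕ) < k then 0 else y.1 i := by
  simp only [killFirst, ContinuousLinearMap.coe_prodMap', Prod.map_fst,
    ContinuousLinearMap.coe_pi']
  split_ifs <;> rfl

theorem killFirst_eq_self {y : (Fin n → 𝕜) × 𝕜} (hy : ∀ i : Fin n, (i : ℕ) < k → y.1 i = 0) :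
    killFirst 𝕜 n k y = y := by
  refine Prod.ext (funext fun i => ?_) rfl
  rw [killFirst_fst]
  split_ifs with h
  · exact (hy i h).symm
  · rfl

/-- Coordinates near a transverse intersection point: the members of the germ ideals are described
by analytic functions on a coordinate space. -/
theorem exists_germ_coordinates (hv : ∀ i, eval v (f i) = 0) (ψ : Module.Dual 𝕜 (Fin (n + 1) → 𝕜))
    (hker : ∀ w, (∀ i, differential (f i) v w = 0) → ψ w = 0 → w = 0) :
    ∃ (y₀ : (Fin n → 𝕜) × 𝕜) (Ψ : (Fin n → 𝕜) × 𝕜 → Fin (n + 1) → 𝕜), y₀.1 = 0 ∧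
      AnalyticAt 𝕜 Ψ y₀ ∧
      (∀ᶠ y in 𝓝 y₀, ∀ i, eval (Ψ y) (f i) = y.1 i) ∧
      ∀ k h, h ∈ germIdeal f k v ↔ ∀ᶠ y in 𝓝 y₀, eval (Ψ (killFirst 𝕜 n k y)) h = 0 := by
  -- The `n` forms are completed by `ψ` to `n + 1` coordinates; `hker` makes the derivative of `Φ`
  -- at `v` invertible, and `Ψ` is its local inverse. Then `Ψ ∘ killFirst` parametrizes the common
  -- zeros of the first `k` forms.
  let Φ : (Fin (n + 1) → 𝕜) → (Fin n → 𝕜) × 𝕜 := fun w => (fun i => eval w (f i), ψ w)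
  let A : (Fin (n + 1) → 𝕜) →ₗ[𝕜] (Fin n → 𝕜) × 𝕜 :=
    (LinearMap.pi fun i => differential (f i) v).prod ψ
  have hAinj : Function.Injective A := by
    refine (injective_iff_map_eq_zero A).2 fun w hw => ?_
    have h1 : (LinearMap.pi fun i => differential (f i) v) w = 0 := congrArg Prod.fst hw
    exact hker w (fun i => congrFun h1 i) (congrArg Prod.snd hw)
  let e : (Fin (n + 1) → 𝕜) ≃L[𝕜] (Fin n → 𝕜) × 𝕜 :=
    (LinearEquiv.ofInjectiveOfFinrankEq A hAinj (by simp)).toContinuousLinearEquiv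
  have hderiv : HasFDerivAt Φ (e : (Fin (n + 1) → 𝕜) →L[𝕜] (Fin n → 𝕜) × 𝕜) v := by
    have h := (hasFDerivAt_pi.2 fun i => hasFDerivAt_eval (f i) v).prodMk
      (ψ.toContinuousLinearMap.hasFDerivAt (x := v))
    convert! h using 1
  have hcont : ContDiff 𝕜 ⊤ Φ := by
    refine ContDiff.prodMk (contDiff_pi.2 fun i => ?_) ψ.toContinuousLinearMap.contDiff
    exact (AnalyticOnNhd.eval_mvPolynomial (f i)).contDiff
  have hΦv : (Φ v).1 = 0 := funext hv
  have hn : (⊤ : WithTop ℕ∞) ≠ 0 := WithTop.top_ne_zero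
  have hc := hcont.contDiffAt (x := v)
  let Ψ := hc.localInverse hderiv hn
  have hΨv : Ψ (Φ v) = v := hc.localInverse_apply_image hderiv hn
  have hΨ : AnalyticAt 𝕜 Ψ (Φ v) := (hc.to_localInverse hderiv hn).analyticAt
  have hstrict := hc.hasStrictFDerivAt' hderiv hn
  have hleft : ∀ᶠ w in 𝓝 v, Ψ (Φ w) = w := hstrict.eventually_left_inverse
  have hright : ∀ᶠ y in 𝓝 (Φ v), Φ (Ψ y) = y := hstrict.eventually_right_inverse
  refine ⟨Φ v, Ψ, hΦv, hΨ, ?_, fun k h => ⟨fun hh => ?_, fun hh => ?_⟩⟩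
  · filter_upwards [hright] with y hy i
    exact congrFun (congrArg Prod.fst hy) i
  · have hfix : killFirst 𝕜 n k (Φ v) = Φ v := killFirst_eq_self fun i _ => congrFun hΦv i
    have hk : Tendsto (killFirst 𝕜 n k) (𝓝 (Φ v)) (𝓝 (Φ v)) := by
      conv => rhs; rw [← hfix]
      exact (killFirst 𝕜 n k).continuous.continuousAt
    have hΨt : Tendsto Ψ (𝓝 (Φ v)) (𝓝 v) := by
      conv => rhs; rw [← hΨv]
      exact hΨ.continuousAt
    filter_upwards [hk.eventually hright, (hΨt.comp hk).eventually (mem_germIdeal.1 hh)] with y h1 h2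
    refine h2 fun i hi => ?_
    have := congrFun (congrArg Prod.fst h1) i
    rw [killFirst_fst, if_pos hi] at this
    exact this
  · have ht : Tendsto Φ (𝓝 v) (𝓝 (Φ v)) := hcont.continuous.continuousAt
    rw [mem_germIdeal]
    filter_upwards [hleft, ht.eventually hh] with w h1 h2 h3
    rwa [killFirst_eq_self (show ∀ i : Fin n, (i : ℕ) < k → (Φ w).1 i = 0 from h3), h1] at h2

/-- In the coordinates `Ψ`, membership means that an analytic germ vanishes, and analytic germs have
no zero divisors. -/
theorem isPrime_germIdeal (hv : ∀ i, eval v (f i) = 0) (ψ : Module.Dual 𝕜 (Fin (n + 1) → 𝕜))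
    (hker : ∀ w, (∀ i, differential (f i) v w = 0) → ψ w = 0 → w = 0) :
    (germIdeal f k v).IsPrime := by
  obtain ⟨y₀, Ψ, hy₀, hΨ, -, hiff⟩ := exists_germ_coordinates hv ψ hker
  refine ⟨fun htop => ?_, fun {a b} hab => ?_⟩
  · have h1 : (1 : MvPolynomial (Fin (n + 1)) 𝕜) ∈ germIdeal f k v := htop ▸ Submodule.mem_top
    simpa using eval_eq_zero_of_mem_germIdeal hv h1
  · rw [hiff] at hab
    rw [hiff, hiff]
    have han (h : MvPolynomial (Fin (n + 1)) 𝕜) :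
        AnalyticAt 𝕜 (fun y => eval (Ψ (killFirst 𝕜 n k y)) h) y₀ := by
      have h1 : AnalyticAt 𝕜 (fun w : Fin (n + 1) → 𝕜 => eval w h)
          (Ψ (killFirst 𝕜 n k y₀)) := AnalyticOnNhd.eval_mvPolynomial h _ trivial
      have h2 : AnalyticAt 𝕜 Ψ (killFirst 𝕜 n k y₀) := by
        rwa [killFirst_eq_self fun i _ => congrFun hy₀ i]
      exact AnalyticAt.comp (g := fun w => eval w h) (f := fun y => Ψ (killFirst 𝕜 n k y)) h1
        (h2.comp ((killFirst 𝕜 n k).analyticAt y₀))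
    exact eventually_eq_zero_of_mul (han a) (han b) (by simpa using hab)

/-- `f i` is the coordinate `i`, the first one that `killFirst 𝕜 n i` leaves free; it is not zero
along its own axis. -/
theorem notMem_germIdeal (hv : ∀ i, eval v (f i) = 0) (ψ : Module.Dual 𝕜 (Fin (n + 1) → 𝕜))
    (hker : ∀ w, (∀ i, differential (f i) v w = 0) → ψ w = 0 → w = 0) (i : Fin n) :
    f i ∉ germIdeal f i v := by
  obtain ⟨y₀, Ψ, hy₀, -, hΨ, hiff⟩ := exists_germ_coordinates hv ψ hker
  rw [hiff]
  intro h
  have hfix : killFirst 𝕜 n i y₀ = y₀ := killFirst_eq_self fun j _ => congrFun hy₀ j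
  have hk : Tendsto (killFirst 𝕜 n i) (𝓝 y₀) (𝓝 y₀) := by
    conv => rhs; rw [← hfix]
    exact (killFirst 𝕜 n i).continuous.continuousAt
  have hz : ∀ᶠ y in 𝓝 y₀, y.1 i = 0 := by
    filter_upwards [h, hk.eventually hΨ] with y h1 h2
    rw [h2, killFirst_fst, if_neg (lt_irrefl _)] at h1
    exact h1
  have ht : Tendsto (fun t : 𝕜 => y₀ + t • ((Pi.single i 1, 0) : (Fin n → 𝕜) × 𝕜)) (𝓝 0)
      (𝓝 y₀) := by
    have hcont : Continuous fun t : 𝕜 => y₀ + t • ((Pi.single i 1, 0) : (Fin n → 𝕜) × 𝕜) := by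
      fun_prop
    simpa using hcont.tendsto 0
  have h0 : ∀ᶠ t : 𝕜 in 𝓝 0, t = 0 := by
    filter_upwards [ht.eventually hz] with t h1
    simpa [hy₀] using h1
  have hne : ∀ᶠ t : 𝕜 in 𝓝[≠] 0, False := by
    filter_upwards [h0.filter_mono nhdsWithin_le_nhds, self_mem_nhdsWithin] with t h1 h2
    exact h2 h1
  simpa using hne.exists

end Germ

end CageVarieties

namespace CageVarieties

open MvPolynomial Filter Topology

/-! ### Homogeneous components -/

section Components

variable {K σ : Type*} [Field K]

theorem homogeneousComponent_add_mul_of_isHomogeneous {g : MvPolynomial σ K} {d : ℕ}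
    (hg : g.IsHomogeneous d) (a : MvPolynomial σ K) (e : ℕ) :
    homogeneousComponent (e + d) (a * g) = homogeneousComponent e a * g := by
  conv_lhs => rw [← sum_homogeneousComponent a, Finset.sum_mul, map_sum]
  have h (i : ℕ) : homogeneousComponent (e + d) (homogeneousComponent i a * g) =
      if i = e then homogeneousComponent e a * g else 0 := by
    rw [homogeneousComponent_of_mem ((homogeneousComponent_isHomogeneous i a).mul hg)]
    by_cases hi : i = e
    · subst hi; simp
    · rw [if_neg hi, if_neg (by omega)]
  simp only [h, Finset.sum_ite_eq', Finset.mem_range]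
  split_ifs with hlt
  · rfl
  · rw [homogeneousComponent_eq_zero _ _ (by omega), zero_mul]

theorem homogeneousComponent_mul_eq_zero {g : MvPolynomial σ K} {d m : ℕ}
    (hg : g.IsHomogeneous d) (a : MvPolynomial σ K) (hm : m < d) :
    homogeneousComponent m (a * g) = 0 := by
  rw [← sum_homogeneousComponent a, Finset.sum_mul, map_sum]
  refine Finset.sum_eq_zero fun i _ => ?_
  rw [homogeneousComponent_of_mem ((homogeneousComponent_isHomogeneous i a).mul hg),
    if_neg (by omega)]

attribute [local instance] MvPolynomial.gradedAlgebra in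
theorem homogeneousComponent_mem_span {F : Set (MvPolynomial σ K)}
    (hF : ∀ f ∈ F, ∃ m, f.IsHomogeneous m) {p : MvPolynomial σ K} (hp : p ∈ Ideal.span F) (m : ℕ) :
    homogeneousComponent m p ∈ Ideal.span F :=
  homogeneousComponent_mem_of_mem (Ideal.homogeneous_span _ _ fun f hf => hF f hf) hp m

end Components

/-! ### Forms cutting out a finite set of points transversally -/

section Nodal

/-- The `n` forms `f` of degree `d` cut out the finite set `N` of points transversally, and they
generate the ideal of `N`. -/
structure IsNodal {K : Type*} [Field K] {n : ℕ} (f : Fin n → MvPolynomial (Fin (n + 1)) K) (d : ℕ)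
    (N : Set (PSpace K n)) : Prop where
  finite : N.Finite
  isHomogeneous : ∀ i, (f i).IsHomogeneous d
  pos : 0 < n → 0 < d
  vanishes : ∀ q ∈ N, ∀ i, Vanishes (f i) q
  linearIndependent : ∀ q ∈ N, LinearIndependent K fun i => tangentDifferential q (f i)
  mem_span : ∀ (h : MvPolynomial (Fin (n + 1)) K) (m : ℕ), h.IsHomogeneous m →
    (∀ q ∈ N, Vanishes h q) → h ∈ Ideal.span (Set.range f)

theorem eq_zero_of_forall_dual {K T ι : Type*} [Field K] [AddCommGroup T] [Module K T]
    [FiniteDimensional K T] [Fintype ι] (D : ι → Module.Dual K T) (hD : LinearIndependent K D)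
    (hcard : Fintype.card ι = Module.finrank K T) {φ : T} (hφ : ∀ i, D i φ = 0) : φ = 0 := by
  have h := (finrank_dualCoannihilator_span_add_iff D).2 hD
  have hbot : (Submodule.span K (Set.range D)).dualCoannihilator = ⊥ :=
    Submodule.finrank_eq_zero.1 (by omega)
  have hmem : φ ∈ (Submodule.span K (Set.range D)).dualCoannihilator := by
    rw [← SetLike.mem_coe, Submodule.coe_dualCoannihilator_span]
    rintro _ ⟨i, rfl⟩
    exact hφ i
  simpa [hbot] using hmem

/-- The differentials of the `f i` vanish together only along the line `q`; any `ψ` that is nonzero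
there completes the coordinates. -/
theorem IsNodal.exists_dual {K : Type*} [Field K] {n d : ℕ}
    {f : Fin n → MvPolynomial (Fin (n + 1)) K} {N : Set (PSpace K n)} (hf : IsNodal f d N)
    {q : PSpace K n} (hq : q ∈ N) : ∃ ψ : Module.Dual K (Fin (n + 1) → K),
      ∀ w, (∀ i, differential (f i) q.rep w = 0) → ψ w = 0 → w = 0 := by
  obtain ⟨ψ, hψ⟩ : ∃ ψ : Module.Dual K (Fin (n + 1) → K), ψ q.rep ≠ 0 := by
    by_contra! h
    exact q.rep_nonzero ((Module.forall_dual_apply_eq_zero_iff K _).1 h)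
  refine ⟨ψ, fun w hw hψw => ?_⟩
  obtain ⟨φ, hφ⟩ := exists_tangent_apply_eq q (q.submodule.mkQ w)
  have hφ0 : φ = 0 := by
    refine eq_zero_of_forall_dual _ (hf.linearIndependent q hq)
      (by rw [finrank_tangent, Fintype.card_fin]) fun i => ?_
    rw [tangentDifferential_apply, ← hw i]
    exact differential_rep_eq (hf.isHomogeneous i) (hf.vanishes q hq i)
      ((mkQ_tangentLift q φ).trans hφ)
  rw [hφ0, LinearMap.zero_apply, eq_comm, Submodule.mkQ_apply, Submodule.Quotient.mk_eq_zero,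
    mem_submodule_iff (rep_mem_submodule q) q.rep_nonzero] at hφ
  obtain ⟨t, rfl⟩ := hφ
  rw [map_smul, smul_eq_mul, mul_eq_zero] at hψw
  rw [hψw.resolve_right hψ, zero_smul]

variable {𝕜 : Type*} [RCLike 𝕜] {n d : ℕ} {f : Fin n → MvPolynomial (Fin (n + 1)) 𝕜}
  {N : Set (PSpace 𝕜 n)}

/-- The ideal generated by the first `k` members of `f`. -/
noncomputable def firstIdeal (f : Fin n → MvPolynomial (Fin (n + 1)) 𝕜) (k : ℕ) :
    Ideal (MvPolynomial (Fin (n + 1)) 𝕜) :=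
  Ideal.span (f '' {i | (i : ℕ) < k})

theorem firstIdeal_succ {k : ℕ} (hk : k < n) :
    firstIdeal f (k + 1) = firstIdeal f k ⊔ Ideal.span {f ⟨k, hk⟩} := by
  rw [firstIdeal, firstIdeal, ← Ideal.span_union, ← Set.image_singleton, ← Set.image_union]
  congr 2
  ext i
  simp only [Set.mem_ofPred_eq, Set.mem_union, Set.mem_singleton_iff, Fin.ext_iff]
  omega

theorem IsNodal.eval_eq_zero (hf : IsNodal f d N) {q : PSpace 𝕜 n} (hq : q ∈ N) (i : Fin n) :
    eval q.rep (f i) = 0 := hf.vanishes q hq i _ (rep_mem_submodule q)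

theorem IsNodal.isPrime (hf : IsNodal f d N) {q : PSpace 𝕜 n} (hq : q ∈ N) (k : ℕ) :
    (germIdeal f k q.rep).IsPrime := by
  obtain ⟨ψ, hψ⟩ := hf.exists_dual hq
  exact isPrime_germIdeal (hf.eval_eq_zero hq) ψ hψ

theorem IsNodal.notMem (hf : IsNodal f d N) {q : PSpace 𝕜 n} (hq : q ∈ N) {k : ℕ} (hk : k < n) :
    f ⟨k, hk⟩ ∉ germIdeal f k q.rep := by
  obtain ⟨ψ, hψ⟩ := hf.exists_dual hq
  exact notMem_germIdeal (hf.eval_eq_zero hq) ψ hψ ⟨k, hk⟩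

theorem IsNodal.firstIdeal_homogeneous (hf : IsNodal f d N) {k : ℕ}
    {p : MvPolynomial (Fin (n + 1)) 𝕜} (hp : p ∈ firstIdeal f k) (m : ℕ) :
    homogeneousComponent m p ∈ firstIdeal f k :=
  homogeneousComponent_mem_span (by rintro _ ⟨i, -, rfl⟩; exact ⟨d, hf.isHomogeneous i⟩) hp m

theorem firstIdeal_le_germIdeal (k : ℕ) (v : Fin (n + 1) → 𝕜) :
    firstIdeal f k ≤ germIdeal f k v :=
  Ideal.span_le.2 <| by rintro _ ⟨i, hi, rfl⟩; exact mem_germIdeal_of_lt hi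

/-- A form which vanishes near all the points of `N` on the common zero set of the first `k`
members of `f` belongs to the ideal generated by these. -/
theorem IsNodal.mem_firstIdeal (hf : IsNodal f d N) {k : ℕ} (hk : k ≤ n) {m : ℕ}
    {h : MvPolynomial (Fin (n + 1)) 𝕜} (hh : h.IsHomogeneous m)
    (hN : ∀ q ∈ N, h ∈ germIdeal f k q.rep) : h ∈ firstIdeal f k := by
  -- At `k = n` the hypothesis yields vanishing at the points of `N`, where `mem_span` applies. The
  -- descent from `k + 1` to `k` is by induction on the degree.
  induction hk using Nat.decreasingInduction generalizing m h with
  | self =>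
    have : f '' {i | (i : ℕ) < n} = Set.range f := by
      rw [← Set.image_univ]
      congr 1
      ext i
      simp
    rw [firstIdeal, this]
    refine hf.mem_span h m hh fun q hq => ?_
    rw [vanishes_iff_eval hh (rep_mem_submodule q) q.rep_nonzero]
    exact eval_eq_zero_of_mem_germIdeal (hf.eval_eq_zero hq) (hN q hq)
  | of_succ k hk ih =>
    induction m using Nat.strong_induction_on generalizing h with
    | _ m ihm =>
    have hmem := ih hh fun q hq => germIdeal_mono k.le_succ (hN q hq)
    rw [firstIdeal_succ hk] at hmem
    obtain ⟨i, hi, g, hg, hig⟩ := Submodule.mem_sup.1 hmem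
    obtain ⟨a, rfl⟩ := Ideal.mem_span_singleton'.1 hg
    have hcomp := congrArg (homogeneousComponent m) hig
    rw [homogeneousComponent_eq_self hh, map_add] at hcomp
    have hi' := hf.firstIdeal_homogeneous hi m
    rcases lt_or_ge m d with hmd | hmd
    · rw [homogeneousComponent_mul_eq_zero (hf.isHomogeneous _) a hmd, add_zero] at hcomp
      rwa [← hcomp]
    · obtain ⟨e, rfl⟩ := Nat.exists_eq_add_of_le' hmd
      rw [homogeneousComponent_add_mul_of_isHomogeneous (hf.isHomogeneous _) a e] at hcomp
      -- Write `h` as an element of `firstIdeal f k` plus a multiple of `f k`. That multiple lies in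
      -- each germ ideal, which is prime and omits `f k`; so the cofactor lies there too, and its
      -- degree is smaller since `d > 0`.
      have ha : homogeneousComponent e a ∈ firstIdeal f k := by
        have hd := hf.pos (by omega)
        refine ihm e (by omega) (homogeneousComponent_isHomogeneous e a) fun q hq => ?_
        have hprod : homogeneousComponent e a * f ⟨k, hk⟩ ∈ germIdeal f k q.rep := by
          rw [← eq_sub_iff_add_eq'] at hcomp
          rw [hcomp]
          exact Ideal.sub_mem _ (hN q hq) (firstIdeal_le_germIdeal k _ hi')
        exact ((hf.isPrime hq k).mem_or_mem hprod).resolve_right (hf.notMem hq hk)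
      rw [← hcomp]
      exact Ideal.add_mem _ hi' (Ideal.mul_mem_right _ _ ha)

/-- The `f i` form a regular sequence: on forms, `firstIdeal f k` is the intersection of prime germ
ideals, none of which contains `f k`. -/
theorem IsNodal.mem_firstIdeal_of_mul_mem (hf : IsNodal f d N) {k : ℕ} (hk : k < n)
    {a : MvPolynomial (Fin (n + 1)) 𝕜} (ha : a * f ⟨k, hk⟩ ∈ firstIdeal f k) :
    a ∈ firstIdeal f k := by
  rw [← sum_homogeneousComponent a]
  refine Ideal.sum_mem _ fun e _ => ?_
  refine hf.mem_firstIdeal hk.le (homogeneousComponent_isHomogeneous e a) fun q hq => ?_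
  have h := hf.firstIdeal_homogeneous ha (e + d)
  rw [homogeneousComponent_add_mul_of_isHomogeneous (hf.isHomogeneous _)] at h
  exact ((hf.isPrime hq k).mem_or_mem (firstIdeal_le_germIdeal k _ h)).resolve_right
    (hf.notMem hq hk)

/-- Elements of a minimal prime over an ideal are zero divisors modulo it, so by regularity each new
`f k` forces a strictly larger prime. -/
theorem IsNodal.le_height (hf : IsNodal f d N) {k : ℕ} (hk : k ≤ n)
    (P : Ideal (MvPolynomial (Fin (n + 1)) 𝕜)) [P.IsPrime] (hP : firstIdeal f k ≤ P) :
    (k : ℕ∞) ≤ P.height := by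
  induction k generalizing P with
  | zero => simp
  | succ k ih =>
    rw [firstIdeal_succ hk, sup_le_iff, Ideal.span_singleton_le_iff_mem] at hP
    obtain ⟨Q, hQ, hQP⟩ := Ideal.exists_minimalPrimes_le hP.1
    have := hQ.isPrime
    have hlt : Q < P := lt_of_le_of_ne hQP fun heq => by
      obtain ⟨y, hy, hxy⟩ := Ideal.exists_mul_mem_of_mem_minimalPrimes hQ (heq ▸ hP.2)
      exact hy (hf.mem_firstIdeal_of_mul_mem hk (by rwa [mul_comm]))
    calc ((k + 1 : ℕ) : ℕ∞) ≤ Q.height + 1 := by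
          push_cast
          gcongr
          exact ih (by omega) Q hQ.le
      _ ≤ P.height := Ideal.height_add_one_le_of_lt_of_isPrime hlt

/-! ### The branches through the points of `N` -/

/-- The Zariski closure of the germ at `q` of the common zero set of the first `k` members
of `f`. -/
def branch (f : Fin n → MvPolynomial (Fin (n + 1)) 𝕜) (k : ℕ) (q : PSpace 𝕜 n) :
    Set (PSpace 𝕜 n) :=
  {x | ∀ g ∈ {g | g ∈ germIdeal f k q.rep ∧ ∃ m, g.IsHomogeneous m}, Vanishes g x}

theorem branch_anti {k l : ℕ} (h : k ≤ l) (q : PSpace 𝕜 n) : branch f l q ⊆ branch f k q :=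
  fun _ hx g hg => hx g ⟨germIdeal_mono h hg.1, hg.2⟩

theorem IsNodal.mem_branch (hf : IsNodal f d N) {q : PSpace 𝕜 n} (hq : q ∈ N) (k : ℕ) :
    q ∈ branch f k q := by
  rintro g ⟨hg, m, hm⟩
  rw [vanishes_iff_eval hm (rep_mem_submodule q) q.rep_nonzero]
  exact eval_eq_zero_of_mem_germIdeal (hf.eval_eq_zero hq) hg

/-- The germ ideal has finitely many generators, which vanish on the local zero set in one common
neighborhood; so nearby zeros lie on the branch, and forms vanishing on the branch lie in the germ
ideal. -/
theorem mem_germIdeal_iff_forall_branch {k m : ℕ} {q : PSpace 𝕜 n}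
    {h : MvPolynomial (Fin (n + 1)) 𝕜} (hh : h.IsHomogeneous m) :
    h ∈ germIdeal f k q.rep ↔ ∀ x ∈ branch f k q, Vanishes h x := by
  refine ⟨fun hg x hx => hx h ⟨hg, m, hh⟩, fun H => ?_⟩
  obtain ⟨S, hS⟩ := (isNoetherianRing_iff_ideal_fg _).1 inferInstance (germIdeal f k q.rep)
  have hall : ∀ᶠ w in 𝓝 q.rep, ∀ g ∈ S,
      (∀ i : Fin n, (i : ℕ) < k → eval w (f i) = 0) → eval w g = 0 :=
    (Finset.eventually_all S).2 fun g hg => mem_germIdeal.1 (hS ▸ Ideal.subset_span hg)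
  rw [mem_germIdeal]
  filter_upwards [hall, isOpen_ne.mem_nhds q.rep_nonzero] with w hw hw0 hfw
  have hker : germIdeal f k q.rep ≤ RingHom.ker (eval w) := by
    rw [← hS]
    exact Ideal.span_le.2 fun g hg => hw g hg hfw
  have hmem : w ∈ (Projectivization.mk 𝕜 w hw0).submodule := by
    rw [Projectivization.submodule_mk]
    exact Submodule.mem_span_singleton_self w
  refine H (Projectivization.mk 𝕜 w hw0) ?_ w hmem
  rintro g ⟨hg, l, hl⟩
  rw [vanishes_iff_eval hl hmem hw0]
  exact hker hg

theorem isAlgebraicSet_branch (k : ℕ) (q : PSpace 𝕜 n) : IsAlgebraicSet (branch f k q) :=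
  ⟨_, fun _ hg => hg.2, rfl⟩

theorem IsNodal.isIrreducibleSet_branch (hf : IsNodal f d N) {q : PSpace 𝕜 n} (hq : q ∈ N)
    (k : ℕ) : IsIrreducibleSet (branch f k q) :=
  isIrreducibleSet_of_forms (germIdeal f k q.rep : Set _) _ (isAlgebraicSet_branch k q)
    ⟨q, hf.mem_branch hq k⟩ (fun _ _ hg => mem_germIdeal_iff_forall_branch hg)
    fun _ _ => (hf.isPrime hq k).mem_or_mem

theorem IsNodal.branch_ssubset (hf : IsNodal f d N) {q : PSpace 𝕜 n} (hq : q ∈ N) {k l : ℕ}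
    (hkl : k < l) (hl : l ≤ n) : branch f l q ⊂ branch f k q := by
  refine ⟨branch_anti hkl.le q, fun hsub => ?_⟩
  refine hf.notMem hq (hkl.trans_le hl)
    ((mem_germIdeal_iff_forall_branch (hf.isHomogeneous _)).2 fun x hx => ?_)
  exact hsub hx _ ⟨mem_germIdeal_of_lt hkl, _, hf.isHomogeneous _⟩

theorem IsNodal.vanishes_of_mem_branch (hf : IsNodal f d N) {q x : PSpace 𝕜 n} {k : ℕ}
    (hx : x ∈ branch f k q) {i : Fin n} (hi : (i : ℕ) < k) : Vanishes (f i) x :=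
  hx _ ⟨mem_germIdeal_of_lt hi, d, hf.isHomogeneous i⟩

/-- Heights of vanishing ideals bound chains from above; the flag of branches of smaller germs at
`q` attains the bound. -/
theorem IsNodal.dim_branch (hf : IsNodal f d N) {q : PSpace 𝕜 n} (hq : q ∈ N) {k : ℕ}
    (hk : k ≤ n) : dim (branch f k q) + (k : WithBot ℕ∞) = (n : WithBot ℕ∞) := by
  obtain ⟨r, rfl⟩ := Nat.exists_eq_add_of_le hk
  suffices h : dim (branch f k q) = ((r : ℕ) : WithBot ℕ∞) by
    rw [h, ← Nat.cast_add, add_comm]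
  refine le_antisymm (iSup_le fun p => ?_) ?_
  · have hprime (i) : (vanishingIdeal (p i).1).IsPrime := (p i).2.1.isPrime
    -- Going down the chain, the height starts at `k` or more, grows at each step and stays at most
    -- `n`.
    have hlen : ∀ i : Fin (p.length + 1),
        (k : ℕ∞) + (p.length - i : ℕ) ≤ (vanishingIdeal (p i).1).height := by
      intro i
      induction i using Fin.reverseInduction with
      | last =>
        simp only [Fin.val_last, Nat.sub_self, Nat.cast_zero, add_zero]
        refine hf.le_height hk _ (Ideal.span_le.2 ?_)
        rintro _ ⟨j, hj, rfl⟩ x hx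
        exact hf.vanishes_of_mem_branch ((p (Fin.last _)).2.2 hx) hj
      | cast i ih =>
        have hlt : (p i.castSucc).1 ⊂ (p i.succ).1 := p.step i
        refine le_trans ?_ ((p i.castSucc).2.1.height_add_one_le (p i.succ).2.1 hlt)
        refine le_trans ?_ (add_le_add_left ih 1)
        rw [add_assoc, ← Nat.cast_add_one, Fin.val_castSucc, Fin.val_succ]
        have : p.length - i = p.length - (i + 1) + 1 := by omega
        rw [this]
    have h0 := hlen 0
    have h1 := h0.trans_lt (p 0).2.1.height_lt
    simp only [Fin.val_zero, Nat.sub_zero] at h1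
    rw [← Nat.cast_add, Nat.cast_lt] at h1
    exact_mod_cast (show p.length ≤ r by omega)
  · let c : LTSeries {Y : Set (PSpace 𝕜 (k + r)) // IsIrreducibleSet Y ∧ Y ⊆ branch f k q} :=
      { length := r
        toFun := fun i => ⟨branch f (k + r - i) q, hf.isIrreducibleSet_branch hq _,
          branch_anti (by omega) q⟩
        step := fun i => by
          have := i.2
          exact hf.branch_ssubset hq (l := k + r - (i.castSucc : Fin (r + 1)))
            (k := k + r - (i.succ : Fin (r + 1)))
            (by simp only [Fin.val_castSucc, Fin.val_succ]; omega) (by omega) }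
    exact Order.LTSeries.length_le_krullDim c

/-! ### The complete intersection -/

/-- The common zero set of the first `k` members of `f`. -/
def firstZeros (f : Fin n → MvPolynomial (Fin (n + 1)) 𝕜) (k : ℕ) : Set (PSpace 𝕜 n) :=
  {x | ∀ i : Fin n, (i : ℕ) < k → Vanishes (f i) x}

/-- Otherwise each germ ideal contains a form not vanishing on `Z`. The product of these forms is in
every germ ideal, hence in `firstIdeal f k`, hence vanishes on `Z`, although the ideal of `Z` is
prime. -/
theorem IsNodal.exists_eq_branch (hf : IsNodal f d N) {k : ℕ} (hk : k ≤ n) {Z : Set (PSpace 𝕜 n)}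
    (hZ : IsComponent (firstZeros f k) Z) : ∃ q ∈ N, Z = branch f k q := by
  suffices h : ∃ q ∈ N, Z ⊆ branch f k q by
    obtain ⟨q, hq, hZq⟩ := h
    exact ⟨q, hq, hZq.antisymm <| hZ.2 ⟨hf.isIrreducibleSet_branch hq k, fun x hx i hi =>
      hf.vanishes_of_mem_branch hx hi⟩ hZq⟩
  by_contra! H
  have hg : ∀ q : N, ∃ g, (g ∈ germIdeal f k q.1.rep ∧ ∃ m, g.IsHomogeneous m) ∧
      g ∉ vanishingIdeal Z := by
    intro q
    obtain ⟨x, hxZ, hx⟩ := Set.not_subset.1 (H q.1 q.2)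
    simp only [branch, Set.mem_ofPred_eq, not_forall] at hx
    obtain ⟨g, hg, hgx⟩ := hx
    exact ⟨g, hg, fun h => hgx (h x hxZ)⟩
  choose g hgerm hgZ using hg
  choose m hm using fun q => (hgerm q).2
  have := hf.finite.fintype
  have hprime := hZ.1.1.isPrime
  have hprod : ∏ q, g q ∈ firstIdeal f k := by
    refine hf.mem_firstIdeal hk (IsHomogeneous.prod _ _ m fun q _ => hm q) fun q hq => ?_
    exact Ideal.mem_of_dvd _ (Finset.dvd_prod_of_mem g (Finset.mem_univ (⟨q, hq⟩ : N)))
      (hgerm ⟨q, hq⟩).1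
  have hZprod : ∏ q, g q ∈ vanishingIdeal Z := fun x hx =>
    vanishes_of_mem_span (by rintro _ ⟨i, hi, rfl⟩; exact hZ.1.2 hx i hi) hprod
  obtain ⟨q, -, hq⟩ := (Ideal.IsPrime.prod_mem_iff).1 hZprod
  exact hgZ q hq

/-- A substitute for the Nullstellensatz, valid over ℝ as well, since all branches lie in the zero
set. -/
theorem IsNodal.mem_firstIdeal_of_forall_vanishes (hf : IsNodal f d N) {k m : ℕ} (hk : k ≤ n)
    {h : MvPolynomial (Fin (n + 1)) 𝕜} (hh : h.IsHomogeneous m)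
    (hV : ∀ x ∈ firstZeros f k, Vanishes h x) : h ∈ firstIdeal f k := by
  refine hf.mem_firstIdeal hk hh fun q hq => ?_
  rw [mem_germIdeal_iff_forall_branch hh]
  exact fun x hx => hV x fun i hi => hf.vanishes_of_mem_branch hx hi

theorem IsNodal.subset_firstZeros (hf : IsNodal f d N) (k : ℕ) : N ⊆ firstZeros f k :=
  fun q hq i _ => hf.vanishes q hq i

/-- Forms vanishing on the zero set are combinations of the first `k` forms, and at `q` the product
rule leaves only the differentials of those. -/
theorem IsNodal.mem_tangentSpace_iff (hf : IsNodal f d N) {k : ℕ} (hk : k ≤ n) {q : PSpace 𝕜 n}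
    (hq : q ∈ N) (φ : Tangent q) : φ ∈ tangentSpace (firstZeros f k) q ↔
      ∀ i : Fin n, (i : ℕ) < k → tangentDifferential q (f i) φ = 0 := by
  rw [tangentSpace, mem_tangentCut_iff fun h hh => ⟨hh.1, hh.2 q (hf.subset_firstZeros k hq)⟩]
  constructor
  · exact fun H i hi => H (f i) ⟨⟨d, hf.isHomogeneous i⟩, fun x hx => hx i hi⟩
  · rintro H h ⟨⟨m, hm⟩, hV⟩
    have hmem := hf.mem_firstIdeal_of_forall_vanishes hk hm hV
    clear hV hm
    induction hmem using Submodule.span_induction with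
    | mem g hg => obtain ⟨i, hi, rfl⟩ := hg; exact H i hi
    | zero => simp
    | add a b _ _ ha hb => rw [map_add, LinearMap.add_apply, ha, hb, add_zero]
    | smul a b hb hbφ =>
      have hbq : Vanishes b q := vanishes_of_mem_span
        (by rintro _ ⟨i, -, rfl⟩; exact hf.vanishes q hq i) hb
      rw [smul_eq_mul, tangentDifferential_mul a hbq, LinearMap.smul_apply, hbφ, smul_zero]

theorem IsNodal.isCompleteIntersection (hf : IsNodal f d N) (hne : N.Nonempty) {s : ℕ}
    (hs : s ≤ n) : IsCompleteIntersection (fun _ : Fin s => d) (firstZeros f s) := by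
  have hV : firstZeros f s = {x | ∀ j : Fin s, Vanishes (f (Fin.castLE hs j)) x} := by
    ext x
    exact ⟨fun h j => h _ j.2, fun h i hi => h ⟨i, hi⟩⟩
  refine ⟨fun Z hZ => ?_, fun j => f (Fin.castLE hs j), fun j => ⟨fun h0 => ?_,
    hf.isHomogeneous _⟩, hV, fun Z hZ => ?_⟩
  · obtain ⟨q, hq, rfl⟩ := hf.exists_eq_branch hs hZ
    exact hf.dim_branch hq hs
  · obtain ⟨q, hq⟩ := hne
    have := (hf.linearIndependent q hq).ne_zero (Fin.castLE hs j)
    simp [h0] at this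
  · obtain ⟨q, hq, rfl⟩ := hf.exists_eq_branch hs hZ
    -- The bad set is where all Jacobian minors vanish; the node `q` itself shows that it does not
    -- contain the branch.
    refine ⟨_, isAlgebraicSet_zeroLocus (Set.range (jacobianMinor fun j => f (Fin.castLE hs j))),
      fun hsub => ?_, fun x hxZ hxB => ?_⟩
    · have hli : LinearIndependent 𝕜 fun j => differential (f (Fin.castLE hs j)) q.rep :=
        (linearIndependent_tangentDifferential_iff fun j =>
          ⟨⟨d, hf.isHomogeneous _⟩, hf.vanishes q hq _⟩).1
          ((hf.linearIndependent q hq).comp _ (Fin.castLE_injective hs))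
      obtain ⟨w, hw⟩ := exists_dual_family hli
      have := hsub (hf.mem_branch hq s) _ ⟨w, rfl⟩ _ (rep_mem_submodule q)
      rw [eval_jacobianMinor] at this
      have hone : (Matrix.of fun j k => differential (f (Fin.castLE hs j)) q.rep (w k)) = 1 := by
        ext j k
        simp [hw, Matrix.one_apply, eq_comm]
      rw [hone, Matrix.det_one] at this
      exact one_ne_zero this
    · have hx : ∀ j : Fin s, (∃ m, (f (Fin.castLE hs j)).IsHomogeneous m) ∧
          Vanishes (f (Fin.castLE hs j)) x := fun j =>
        ⟨⟨d, hf.isHomogeneous _⟩, hf.vanishes_of_mem_branch hxZ j.2⟩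
      rw [finrank_iInf_tangentCut_iff hx, linearIndependent_tangentDifferential_iff hx]
      simp only [Set.forall_mem_range, Set.mem_ofPred_eq, not_forall] at hxB
      obtain ⟨w, hw⟩ := hxB
      obtain ⟨v, hv, hv0, hvw⟩ := exists_ne_zero_eval_ne_zero hw
      rw [eval_jacobianMinor] at hvw
      have hli := linearIndependent_of_det_ne_zero hvw
      obtain ⟨t, ht⟩ := (mem_submodule_iff hv hv0).1 (rep_mem_submodule x)
      have ht0 : t ≠ 0 := by
        rintro rfl
        exact x.rep_nonzero (by rw [← ht, zero_smul])
      have := hli.units_smul fun _ => Units.mk0 (t ^ (d - 1)) (pow_ne_zero _ ht0)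
      convert this using 2 with j
      rw [← ht, differential_smul (hf.isHomogeneous _)]
      rfl

end Nodal

/-! ### The nodes of a cage -/

section Nodes

variable {K : Type*} [Field K] {n d : ℕ}

/-- Equations `φ` of the hyperplanes of a cage and a numbering `x` of its nodes. -/
structure CageGrid (C : Cage K n d) (φ : Fin n → Fin d → Module.Dual K (Fin (n + 1) → K))
    (x : (Fin n → Fin d) → PSpace K n) : Prop where
  ker_eq : ∀ j i, LinearMap.ker (φ j i) = C.H j i
  submodule_eq : ∀ c, (x c).submodule = ⨅ j, C.H j (c j)
  range_eq : Set.range x = C.nodes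
  apply_rep_eq_zero_iff : ∀ c j i, φ j i (x c).rep = 0 ↔ i = c j

/-- Nodes inject into the `d ^ n` multi-indices and there are `d ^ n` of them, so every choice of
one hyperplane per color gives a node, and different choices give different nodes. -/
theorem Cage.exists_grid (C : Cage K n d) : ∃ φ x, CageGrid C φ x := by
  have hφ : ∀ j i, ∃ φ : Module.Dual K (Fin (n + 1) → K), LinearMap.ker φ = C.H j i := by
    intro j i
    have hlt : C.H j i < ⊤ := Submodule.lt_top_of_finrank_lt_finrank (by simp [C.finrank_H j i])
    obtain ⟨φ, hφ0, hφ⟩ := Submodule.exists_le_ker_of_lt_top _ hlt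
    refine ⟨φ, (Submodule.eq_of_le_of_finrank_le hφ ?_).symm⟩
    have h1 : Module.finrank K (LinearMap.ker φ) < n + 1 := by
      have := Submodule.finrank_lt (s := LinearMap.ker φ)
        (lt_top_iff_ne_top.2 fun h => hφ0 (LinearMap.ker_eq_top.1 h)).ne
      simpa using this
    rw [C.finrank_H]
    omega
  choose φ hφ using hφ
  choose c hc using fun q : C.nodes => q.2
  have hinj : Function.Injective c := fun q r h =>
    Subtype.ext (Projectivization.submodule_injective (by rw [hc, hc, h]))
  have := Finite.of_injective c hinj
  have hbij : Function.Bijective c := hinj.bijective_of_nat_card_le (by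
    rw [Nat.card_coe_set_eq, Cage.nodes, C.ncard_nodeSet]
    simp)
  let e := Equiv.ofBijective c hbij
  have hsub (a) : ((e.symm a).1 : PSpace K n).submodule = ⨅ j, C.H j (a j) := by
    rw [hc]
    exact iInf_congr fun j => by rw [show c (e.symm a) = a from e.apply_symm_apply a]
  refine ⟨φ, fun a => (e.symm a).1, hφ, hsub, ?_, fun a j i => ⟨fun h => ?_, ?_⟩⟩
  · ext q
    constructor
    · rintro ⟨a, rfl⟩
      exact (e.symm a).2
    · exact fun hq => ⟨c ⟨q, hq⟩, congrArg Subtype.val (e.symm_apply_apply ⟨q, hq⟩)⟩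
  · let b := Function.update a j i
    have hb : (e.symm b).1 = (e.symm a).1 := by
      refine Projectivization.submodule_injective
        (Submodule.eq_of_le_of_finrank_le ?_ (by simp [Projectivization.finrank_submodule])).symm
      have hrep := rep_mem_submodule (e.symm a).1
      rw [(e.symm a).1.submodule_eq, Submodule.span_singleton_le_iff_mem, hsub b,
        Submodule.mem_iInf]
      intro k
      rw [hsub a, Submodule.mem_iInf] at hrep
      by_cases hk : k = j
      · subst hk
        simpa [b, ← hφ] using h
      · simpa [b, hk] using hrep k
    have hab : b = a := e.symm.injective (Subtype.ext hb)
    simpa [b] using congrFun hab j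
  · rintro rfl
    have hrep := rep_mem_submodule (e.symm a).1
    rw [hsub a, Submodule.mem_iInf] at hrep
    simpa [← hφ] using hrep j

variable {C : Cage K n d} {φ : Fin n → Fin d → Module.Dual K (Fin (n + 1) → K)}
  {x : (Fin n → Fin d) → PSpace K n}

theorem CageGrid.mem_submodule_iff (h : CageGrid C φ x) (c : Fin n → Fin d)
    (w : Fin (n + 1) → K) : w ∈ (x c).submodule ↔ ∀ j, φ j (c j) w = 0 := by
  simp [h.submodule_eq, ← h.ker_eq]

theorem CageGrid.linearIndependent (h : CageGrid C φ x) (c : Fin n → Fin d) :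
    LinearIndependent K fun j => φ j (c j) := by
  rw [← finrank_dualCoannihilator_span_add_iff]
  have : (Submodule.span K (Set.range fun j => φ j (c j))).dualCoannihilator =
      (x c).submodule := by
    ext w
    rw [h.mem_submodule_iff, ← SetLike.mem_coe, Submodule.coe_dualCoannihilator_span]
    simp
  rw [this, Projectivization.finrank_submodule]
  simp [add_comm]

theorem CageGrid.span_eq_top (h : CageGrid C φ x) (c : Fin n → Fin d)
    {ψ : Module.Dual K (Fin (n + 1) → K)} (hψ : ψ (x c).rep ≠ 0) :
    Submodule.span K (insert ψ (Set.range fun j => φ j (c j))) = ⊤ := by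
  rw [← Subspace.dualCoannihilator_dualAnnihilator_eq
    (W := Submodule.span K (insert ψ (Set.range fun j => φ j (c j))))]
  have : (Submodule.span K (insert ψ (Set.range fun j => φ j (c j)))).dualCoannihilator = ⊥ := by
    refine (Submodule.eq_bot_iff _).2 fun w hw => ?_
    rw [← SetLike.mem_coe, Submodule.coe_dualCoannihilator_span] at hw
    obtain ⟨t, rfl⟩ := (CageVarieties.mem_submodule_iff (rep_mem_submodule (x c))
      (x c).rep_nonzero).1 ((h.mem_submodule_iff c w).2 fun j => hw _ (Or.inr ⟨j, rfl⟩))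
    have h0 := hw ψ (Or.inl rfl)
    rw [map_smul, smul_eq_mul] at h0
    rw [(mul_eq_zero.1 h0).resolve_right hψ, zero_smul]
  rw [this, Submodule.dualAnnihilator_bot]

theorem CageGrid.vanishes_colorForm (h : CageGrid C φ x) {q : PSpace K n} (hq : q ∈ C.nodes)
    (j : Fin n) : Vanishes (colorForm φ j) q := by
  rw [← h.range_eq] at hq
  obtain ⟨c, rfl⟩ := hq
  rw [vanishes_iff_eval (isHomogeneous_colorForm φ j) (rep_mem_submodule _) (x c).rep_nonzero,
    colorForm, map_prod]
  exact Finset.prod_eq_zero (Finset.mem_univ (c j))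
    (by rw [eval_linearForm, h.apply_rep_eq_zero_iff])

/-- In each color only the factor through the node survives the product rule, times a nonzero
scalar; those factors are independent. -/
theorem CageGrid.linearIndependent_tangentDifferential (h : CageGrid C φ x) {q : PSpace K n}
    (hq : q ∈ C.nodes) : LinearIndependent K fun j => tangentDifferential q (colorForm φ j) := by
  rw [linearIndependent_tangentDifferential_iff fun j =>
    ⟨⟨d, isHomogeneous_colorForm φ j⟩, h.vanishes_colorForm hq j⟩]
  rw [← h.range_eq] at hq
  obtain ⟨c, rfl⟩ := hq
  have hne (j : Fin n) : ∏ i ∈ Finset.univ.erase (c j), φ j i (x c).rep ≠ 0 :=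
    Finset.prod_ne_zero_iff.2 fun i hi => by
      rw [Ne, h.apply_rep_eq_zero_iff]
      exact Finset.ne_of_mem_erase hi
  have := (h.linearIndependent c).units_smul fun j => Units.mk0 _ (hne j)
  convert this using 2 with j
  rw [colorForm, ← Finset.mul_prod_erase _ _ (Finset.mem_univ (c j)), differential_mul,
    eval_linearForm, (h.apply_rep_eq_zero_iff c j (c j)).2 rfl, zero_smul, zero_add,
    differential_linearForm, map_prod]
  simp only [eval_linearForm]
  rfl

variable [Infinite K]

/-- A linear form `ψ` avoiding all nodes exists over an infinite field, and reordering the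
hyperplanes within a color leaves the color forms unchanged. -/
theorem CageGrid.mem_span_of_simplicial (h : CageGrid C φ x) (hne : C.nodes.Nonempty)
    (σ : Fin n → Equiv.Perm (Fin d)) {m : ℕ} {g : MvPolynomial (Fin (n + 1)) K}
    (hg : g.IsHomogeneous m)
    (hv : ∀ c : Fin n → Fin d, ∑ j, (c j : ℕ) ≤ m → Vanishes g (x fun j => σ j (c j))) :
    g ∈ Ideal.span (Set.range (colorForm φ)) := by
  obtain ⟨ψ, hψ⟩ := Module.exists_dual_forall_apply_ne_zero (K := K)
    (fun c : Fin n → Fin d => (x c).rep) fun c => (x c).rep_nonzero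
  obtain ⟨_, c₀, -⟩ : (Set.range x).Nonempty := h.range_eq ▸ hne
  have hcolor : colorForm (fun j i => φ j (σ j i)) = colorForm φ := by
    ext1 j
    exact Equiv.prod_comp (σ j) fun i => linearForm (φ j i)
  rw [← hcolor]
  have hspan (c : Fin n → Fin d) :
      Submodule.span K (insert ψ (Set.range fun j => φ j (σ j (c j)))) = ⊤ :=
    h.span_eq_top (fun j => σ j (c j)) (hψ _)
  have hφ (c : Fin n → Fin d) (j : Fin n) (i : Fin d) :
      φ j (σ j i) (x fun j => σ j (c j)).rep = 0 ↔ i = c j := by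
    rw [h.apply_rep_eq_zero_iff]
    exact (σ j).injective.eq_iff
  exact mem_span_colorForm (fun j i => φ j (σ j i)) ψ hspan c₀
    (fun c => (x fun j => σ j (c j)).rep) (fun c => hψ _) hφ hg
    fun c hc => hv c hc _ (rep_mem_submodule _)

theorem CageGrid.isNodal (h : CageGrid C φ x) (hne : C.nodes.Nonempty) :
    IsNodal (colorForm φ) d C.nodes where
  finite := h.range_eq ▸ Set.finite_range x
  isHomogeneous := isHomogeneous_colorForm φ
  pos hn := by
    rw [← h.range_eq] at hne
    obtain ⟨_, c, -⟩ := hne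
    exact (c ⟨0, hn⟩).pos
  vanishes _ hq := h.vanishes_colorForm hq
  linearIndependent _ hq := h.linearIndependent_tangentDifferential hq
  mem_span g m hg hv := h.mem_span_of_simplicial hne (fun _ => Equiv.refl _) hg
    fun c _ => hv _ (h.range_eq ▸ ⟨c, rfl⟩)

end Nodes

/-! ### Linear systems spanned by forms cutting out a finite set transversally -/

section LinearSystem

variable {K : Type*} [Field K] {n d : ℕ} {f : Fin n → MvPolynomial (Fin (n + 1)) K}
  {N : Set (PSpace K n)}

theorem isHomogeneous_linearCombination (hf : ∀ i, (f i).IsHomogeneous d) (l : Fin n → K) :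
    (Fintype.linearCombination K f l).IsHomogeneous d := by
  rw [Fintype.linearCombination_apply]
  exact IsHomogeneous.sum _ _ _ fun i _ => by
    rw [smul_eq_C_mul]; exact (hf i).C_mul _

theorem vanishes_linearCombination {q : PSpace K n} (hf : ∀ i, Vanishes (f i) q) (l : Fin n → K) :
    Vanishes (Fintype.linearCombination K f l) q := by
  intro v hv
  simp [Fintype.linearCombination_apply, smul_eval, hf _ v hv]

/-- Comparing components of degree `d`, only the constant terms of the cofactors contribute. -/
theorem exists_linearCombination_eq (hf : ∀ i, (f i).IsHomogeneous d)
    {h : MvPolynomial (Fin (n + 1)) K} (hh : h.IsHomogeneous d)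
    (hmem : h ∈ Ideal.span (Set.range f)) : ∃ l, h = Fintype.linearCombination K f l := by
  obtain ⟨a, ha⟩ := (Submodule.mem_span_range_iff_exists_fun _).1 hmem
  refine ⟨fun i => coeff 0 (a i), ?_⟩
  have := congrArg (homogeneousComponent (0 + d)) ha
  simp only [smul_eq_mul, map_sum,
    fun i => homogeneousComponent_add_mul_of_isHomogeneous (hf i) (a i) 0] at this
  rw [zero_add, homogeneousComponent_eq_self hh] at this
  rw [← this, Fintype.linearCombination_apply]
  exact Finset.sum_congr rfl fun i _ => by rw [homogeneousComponent_zero, smul_eq_C_mul]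

/-- The hypotheses concern only the span of the `f i`. This reduces any base locus to the zero set
of the first members of a family. -/
theorem IsNodal.basis (hf : IsNodal f d N) (b : Module.Basis (Fin n) K (Fin n → K)) :
    IsNodal (fun i => Fintype.linearCombination K f (b i)) d N where
  finite := hf.finite
  isHomogeneous i := isHomogeneous_linearCombination hf.isHomogeneous _
  pos := hf.pos
  vanishes q hq i := vanishes_linearCombination (hf.vanishes q hq) _
  linearIndependent q hq := by
    have hinj : LinearMap.ker (tangentDifferential q ∘ₗ Fintype.linearCombination K f) = ⊥ := by
      refine LinearMap.ker_eq_bot'.2 fun l hl => funext ?_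
      refine Fintype.linearIndependent_iff.1 (hf.linearIndependent q hq) l ?_
      rw [LinearMap.comp_apply, Fintype.linearCombination_apply, map_sum] at hl
      simpa only [map_smul] using hl
    have hli := b.linearIndependent.map'
      (tangentDifferential q ∘ₗ Fintype.linearCombination K f) hinj
    simpa only [Function.comp_def, LinearMap.comp_apply] using hli
  mem_span h m hh hN := by
    refine Ideal.span_le.2 ?_ (hf.mem_span h m hh hN)
    rintro _ ⟨k, rfl⟩
    have hk : f k = Fintype.linearCombination K f (Pi.single k 1) := by
      rw [Fintype.linearCombination_apply_single, one_smul]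
    rw [hk, ← b.sum_repr (Pi.single k 1), map_sum]
    refine Ideal.sum_mem _ fun i _ => ?_
    rw [map_smul, smul_eq_C_mul]
    exact Ideal.mul_mem_left _ _ (Ideal.subset_span ⟨i, rfl⟩)

/-- The coordinates on the tangent space at a point given by the differentials of the forms. -/
noncomputable def IsNodal.tangentEquiv (hf : IsNodal f d N) {q : PSpace K n} (hq : q ∈ N) :
    Tangent q ≃ₗ[K] (Fin n → K) :=
  LinearEquiv.ofInjectiveOfFinrankEq (LinearMap.pi fun i => tangentDifferential q (f i))
    ((injective_iff_map_eq_zero _).2 fun φ hφ =>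
      eq_zero_of_forall_dual _ (hf.linearIndependent q hq)
        (by rw [finrank_tangent, Fintype.card_fin]) fun i => congrFun hφ i)
    (by rw [finrank_tangent, Module.finrank_fin_fun])

theorem IsNodal.tangentDifferential_linearCombination (hf : IsNodal f d N) {q : PSpace K n}
    (hq : q ∈ N) (l : Fin n → K) (φ : Tangent q) :
    tangentDifferential q (Fintype.linearCombination K f l) φ = l ⬝ᵥ hf.tangentEquiv hq φ := by
  simp only [Fintype.linearCombination_apply, map_sum, map_smul, LinearMap.sum_apply,
    LinearMap.smul_apply, smul_eq_mul, dotProduct]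
  rfl

/-- The orthogonal complement of a subspace of `K^n` with respect to the dot product. -/
noncomputable def dotPerp (W : Submodule K (Fin n → K)) : Submodule K (Fin n → K) :=
  W.dualAnnihilator.comap (dotProductEquiv K (Fin n)).toLinearMap

theorem mem_dotPerp {W : Submodule K (Fin n → K)} {l : Fin n → K} :
    l ∈ dotPerp W ↔ ∀ w ∈ W, l ⬝ᵥ w = 0 := by
  simp [dotPerp, Submodule.mem_dualAnnihilator]

theorem forall_dotPerp_iff {W : Submodule K (Fin n → K)} {w : Fin n → K} :
    (∀ l ∈ dotPerp W, l ⬝ᵥ w = 0) ↔ w ∈ W := by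
  rw [← Subspace.forall_mem_dualAnnihilator_apply_eq_zero_iff W w]
  constructor
  · intro h θ hθ
    have := h ((dotProductEquiv K (Fin n)).symm θ) (by simpa [dotPerp] using hθ)
    rw [← dotProductEquiv_apply_apply, LinearEquiv.apply_symm_apply] at this
    exact this
  · exact fun h l hl => h (dotProductEquiv K (Fin n) l) hl

theorem finrank_dotPerp (W : Submodule K (Fin n → K)) :
    Module.finrank K (dotPerp W) + Module.finrank K W = n := by
  have h1 : Module.finrank K (dotPerp W) = Module.finrank K W.dualAnnihilator :=
    LinearEquiv.finrank_eq ((dotProductEquiv K (Fin n)).ofSubmodule' _)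
  have h2 := Subspace.finrank_add_finrank_dualAnnihilator_eq W
  rw [Module.finrank_fin_fun] at h2
  omega

theorem exists_basis_span_eq {V : Type*} [AddCommGroup V] [Module K V] [FiniteDimensional K V]
    (hV : Module.finrank K V = n) {s : ℕ} (W : Submodule K V) (hW : Module.finrank K W = s) :
    ∃ b : Module.Basis (Fin n) K V, Submodule.span K (b '' {i | (i : ℕ) < s}) = W := by
  obtain ⟨W', hc⟩ := W.exists_isCompl
  have hsum := Submodule.finrank_add_eq_of_isCompl hc
  let e : Fin s ⊕ Fin (n - s) ≃ Fin n := finSumFinEquiv.trans (finCongr (by omega))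
  let b := (((Module.finBasisOfFinrankEq K W hW).prod
    (Module.finBasisOfFinrankEq K W' (n := n - s) (by omega))).map
      (Submodule.prodEquivOfIsCompl W W' hc)).reindex e
  refine ⟨b, ?_⟩
  have hset : b '' {i | (i : ℕ) < s} =
      W.subtype '' Set.range (Module.finBasisOfFinrankEq K W hW) := by
    ext v
    constructor
    · rintro ⟨i, hi, rfl⟩
      obtain ⟨i, rfl⟩ := e.surjective i
      rcases i with i | i
      · exact ⟨_, ⟨i, rfl⟩, by simp [b]⟩
      · simp [e] at hi
    · rintro ⟨_, ⟨i, rfl⟩, rfl⟩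
      exact ⟨e (Sum.inl i), by simp [e], by simp [b]⟩
  rw [hset, Submodule.span_image, Module.Basis.span_eq, Submodule.map_top, Submodule.range_subtype]

end LinearSystem

/-! ### The complete intersection with a prescribed tangent space -/

section Prescribed

/-- The base locus of the linear system of the combinations of `f` with coefficients in `Λ`. -/
def baseLocus {K : Type*} [Field K] {n : ℕ} (f : Fin n → MvPolynomial (Fin (n + 1)) K)
    (Λ : Submodule K (Fin n → K)) : Set (PSpace K n) :=
  {x | ∀ l ∈ Λ, Vanishes (Fintype.linearCombination K f l) x}

theorem baseLocus_span {K : Type*} [Field K] {n : ℕ} (f : Fin n → MvPolynomial (Fin (n + 1)) K)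
    (S : Set (Fin n → K)) : baseLocus f (Submodule.span K S) =
      {x | ∀ l ∈ S, Vanishes (Fintype.linearCombination K f l) x} := by
  ext x
  refine ⟨fun h l hl => h l (Submodule.subset_span hl), fun h l hl => ?_⟩
  induction hl using Submodule.span_induction with
  | mem l hl => exact h l hl
  | zero => rw [map_zero]; exact vanishes_zero x
  | add a b _ _ ha hb => rw [map_add]; exact ha.add hb
  | smul c a _ ha => rw [map_smul, smul_eq_C_mul]; exact ha.mul_left _

variable {𝕜 : Type*} [RCLike 𝕜] {n d s : ℕ} {f : Fin n → MvPolynomial (Fin (n + 1)) 𝕜}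
  {N : Set (PSpace 𝕜 n)}

theorem exists_basis_baseLocus_eq (Λ : Submodule 𝕜 (Fin n → 𝕜))
    (hΛ : Module.finrank 𝕜 Λ = s) : ∃ b : Module.Basis (Fin n) 𝕜 (Fin n → 𝕜),
      Submodule.span 𝕜 (b '' {i | (i : ℕ) < s}) = Λ ∧
      baseLocus f Λ = firstZeros (fun i => Fintype.linearCombination 𝕜 f (b i)) s := by
  obtain ⟨b, hb⟩ := exists_basis_span_eq (Module.finrank_fin_fun 𝕜) Λ hΛ
  refine ⟨b, hb, ?_⟩
  rw [← hb, baseLocus_span]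
  simp [firstZeros]

theorem IsNodal.isCompleteIntersection_baseLocus (hf : IsNodal f d N) (hne : N.Nonempty)
    (hs : s ≤ n) (Λ : Submodule 𝕜 (Fin n → 𝕜)) (hΛ : Module.finrank 𝕜 Λ = s) :
    IsCompleteIntersection (fun _ : Fin s => d) (baseLocus f Λ) := by
  obtain ⟨b, -, hb⟩ := exists_basis_baseLocus_eq (f := f) Λ hΛ
  rw [hb]
  exact (hf.basis b).isCompleteIntersection hne hs

theorem IsNodal.subset_baseLocus (hf : IsNodal f d N) (Λ : Submodule 𝕜 (Fin n → 𝕜)) :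
    N ⊆ baseLocus f Λ := fun q hq l _ => vanishes_linearCombination (hf.vanishes q hq) l

/-- In the coordinates `tangentEquiv` the combination with coefficients `l` has differential `l ⬝ᵥ
·`, so the tangent space is the double complement of `W`. The same `W` serves every point of `N`. -/
theorem IsNodal.tangentSpace_baseLocus (hf : IsNodal f d N) (hs : s ≤ n)
    (W : Submodule 𝕜 (Fin n → 𝕜)) (hW : Module.finrank 𝕜 W = n - s) {q : PSpace 𝕜 n}
    (hq : q ∈ N) : tangentSpace (baseLocus f (dotPerp W)) q =
      W.map (hf.tangentEquiv hq).symm.toLinearMap := by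
  obtain ⟨b, hspan, hb⟩ := exists_basis_baseLocus_eq (f := f) (s := s) (dotPerp W)
    (by have := finrank_dotPerp W; omega)
  ext φ
  rw [hb, (hf.basis b).mem_tangentSpace_iff hs hq]
  simp only [hf.tangentDifferential_linearCombination hq]
  have hmap : φ ∈ W.map (hf.tangentEquiv hq).symm.toLinearMap ↔ hf.tangentEquiv hq φ ∈ W := by
    rw [Submodule.mem_map_equiv, LinearEquiv.symm_symm]
  rw [hmap, ← forall_dotPerp_iff, ← hspan]
  constructor
  · intro h l hl
    induction hl using Submodule.span_induction with
    | mem l hl => obtain ⟨i, hi, rfl⟩ := hl; exact h i hi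
    | zero => exact zero_dotProduct _
    | add a b _ _ ha hb => rw [add_dotProduct, ha, hb, add_zero]
    | smul c a _ ha => rw [smul_dotProduct, ha, smul_zero]
  · exact fun h i hi => h _ (Submodule.subset_span ⟨i, hi, rfl⟩)

/-- A complete intersection of the right type on which all the forms of degree `d` are combinations
of the `f i` is determined by its tangent space at a point of `N`. -/
theorem IsNodal.eq_baseLocus (hf : IsNodal f d N) (hs : s ≤ n) {V : Set (PSpace 𝕜 n)}
    (hV : IsCompleteIntersection (fun _ : Fin s => d) V)
    (hspan : ∀ h : MvPolynomial (Fin (n + 1)) 𝕜, h.IsHomogeneous d → (∀ x ∈ V, Vanishes h x) →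
      h ∈ Ideal.span (Set.range f)) {p : PSpace 𝕜 n} (hp : p ∈ N)
    (hT : Module.finrank 𝕜 (tangentSpace V p) = n - s) :
    V = baseLocus f
      (dotPerp ((tangentSpace V p).map (hf.tangentEquiv hp).toLinearMap)) := by
  obtain ⟨-, g, hg, hVg, hgen⟩ := hV
  have hvan : ∀ j, ∀ x ∈ V, Vanishes (g j) x := fun j x hx => by
    rw [hVg] at hx; exact hx j
  choose l hl using fun j => exists_linearCombination_eq hf.isHomogeneous (hg j).2
    (hspan (g j) (hg j).2 (hvan j))
  have hpV : p ∈ V := by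
    rw [hVg]
    intro j
    rw [hl]
    exact vanishes_linearCombination (hf.vanishes p hp) _
  -- `V` contains `p`, so it has a component; transversality of the defining forms at a generic
  -- point of it makes their coefficient vectors independent.
  have hli : LinearIndependent 𝕜 l := by
    have halg : IsAlgebraicSet V :=
      ⟨Set.range g, by rintro _ ⟨j, rfl⟩; exact ⟨d, (hg j).2⟩, by rw [hVg]; simp⟩
    obtain ⟨Z, hZ⟩ := exists_isComponent halg ⟨p, hpV⟩
    obtain ⟨B, -, hZB, hB⟩ := hgen Z hZ
    obtain ⟨x, hxZ, hxB⟩ := Set.not_subset.1 hZB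
    have := (finrank_iInf_tangentCut_iff fun j =>
      ⟨⟨d, (hg j).2⟩, hvan j x (hZ.1.2 hxZ)⟩).1 (hB x hxZ hxB)
    refine LinearIndependent.of_comp (tangentDifferential x ∘ₗ Fintype.linearCombination 𝕜 f) ?_
    convert this using 2 with j
    rw [hl j]
    rfl
  set W := (tangentSpace V p).map (hf.tangentEquiv hp).toLinearMap with hWdef
  have hW : Module.finrank 𝕜 W = n - s := by rw [← hT]; exact LinearEquiv.finrank_map_eq _ _
  have hle : Submodule.span 𝕜 (Set.range l) ≤ dotPerp W := by
    refine Submodule.span_le.2 ?_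
    rintro _ ⟨j, rfl⟩
    rw [SetLike.mem_coe, mem_dotPerp]
    rintro _ ⟨φ, hφ, rfl⟩
    rw [LinearEquiv.coe_coe, ← hf.tangentDifferential_linearCombination hp, ← hl]
    exact (mem_tangentCut_iff (fun h hh => ⟨hh.1, hh.2 p hpV⟩) φ).1 hφ (g j)
      ⟨⟨d, (hg j).2⟩, hvan j⟩
  -- Both sides have dimension `s = n - (n - s)`.
  have heq : Submodule.span 𝕜 (Set.range l) = dotPerp W := by
    refine Submodule.eq_of_le_of_finrank_le hle ?_
    rw [finrank_span_eq_card hli, Fintype.card_fin]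
    have := finrank_dotPerp W
    omega
  rw [← heq, baseLocus_span, hVg]
  simp [← hl]

end Prescribed

end CageVarieties

namespace CageVarieties

/-! ### Grassmannian embeddings induced by linear isomorphisms -/

section Embedding

variable {K : Type*} [Field K] {k : ℕ} {T : Type*} [AddCommGroup T] [Module K T]
  {ι : Type*} {S : ι → Type*} [∀ i, AddCommGroup (S i)] [∀ i, Module K (S i)]

theorem dual_mem_polyFunctions {M : Type*} [AddCommGroup M] [Module K M] (φ : Module.Dual K M) :
    (φ : M → K) ∈ polyFunctions K M := Algebra.subset_adjoin ⟨φ, rfl⟩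

theorem isPolynomialMap_linearMap {M N : Type*} [AddCommGroup M] [Module K M] [AddCommGroup N]
    [Module K N] (g : M →ₗ[K] N) : IsPolynomialMap K (g : M → N) :=
  fun φ => dual_mem_polyFunctions (φ ∘ₗ g)

theorem det_mem_polyFunctions {M : Type*} [AddCommGroup M] [Module K M] {m : ℕ}
    (θ : Fin m → Fin m → Module.Dual K M) :
    (fun v => (Matrix.of fun a b => θ a b v).det) ∈ polyFunctions K M := by
  let A : Matrix (Fin m) (Fin m) (polyFunctions K M) :=
    Matrix.of fun a b => ⟨θ a b, dual_mem_polyFunctions (θ a b)⟩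
  convert A.det.2 using 1
  ext v
  have h1 := AlgHom.map_det (polyFunctions K M).val A
  have h2 := RingHom.map_det (Pi.evalRingHom (fun _ : M => K) v)
    ((polyFunctions K M).val.mapMatrix A)
  change _ = Pi.evalRingHom (fun _ : M => K) v ((polyFunctions K M).val A.det)
  rw [h1, h2]
  rfl

/-- Turns linear dependence into the vanishing of polynomials in the vectors. -/
theorem exists_det_ne_zero_iff {m : ℕ} (x : Fin m → T) :
    (∃ θ : Fin m → Module.Dual K T, (Matrix.of fun a b => θ a (x b)).det ≠ 0) ↔
      LinearIndependent K x := by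
  constructor
  · rintro ⟨θ, hθ⟩
    refine LinearIndependent.of_comp (Module.Dual.eval K T) ?_
    refine linearIndependent_of_det_ne_zero (w := θ) ?_
    rwa [← Matrix.det_transpose] at hθ
  · intro hx
    obtain ⟨θ, hθ⟩ := exists_dual_family (hx.map' (Module.Dual.eval K T) (Module.eval_ker K T))
    refine ⟨θ, ?_⟩
    have : (Matrix.of fun a b => θ a (x b)) = 1 := by
      ext a b
      simpa [Matrix.one_apply] using hθ b a
    rw [this, Matrix.det_one]
    exact one_ne_zero

/-- The map of Grassmannians induced by a linear isomorphism. -/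
noncomputable def Gr.map {T' : Type*} [AddCommGroup T'] [Module K T'] (e : T ≃ₗ[K] T')
    (τ : Gr K T k) : Gr K T' k :=
  ⟨τ.1.map e.toLinearMap, by rw [LinearEquiv.finrank_map_eq, τ.2]⟩

theorem Gr.map_ofFrame {T' : Type*} [AddCommGroup T'] [Module K T'] (e : T ≃ₗ[K] T')
    (v : Fin k → T) (hv : LinearIndependent K v) (hv' : LinearIndependent K fun j => e (v j)) :
    Gr.map e (Gr.ofFrame v hv) = Gr.ofFrame (fun j => e (v j)) hv' := by
  refine Subtype.ext ?_
  change (Submodule.span K (Set.range v)).map e.toLinearMap = Submodule.span K _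
  rw [Submodule.map_span, ← Set.range_comp]
  rfl

theorem Gr.map_symm_map {T' : Type*} [AddCommGroup T'] [Module K T'] (e : T ≃ₗ[K] T')
    (τ : Gr K T k) : Gr.map e.symm (Gr.map e τ) = τ := by
  refine Subtype.ext ?_
  change (τ.1.map e.toLinearMap).map e.symm.toLinearMap = τ.1
  rw [← Submodule.map_comp]
  simp

theorem isRegularMap_map {T' : Type*} [AddCommGroup T'] [Module K T'] (e : T ≃ₗ[K] T') :
    IsRegularMap (Gr.map e : Gr K T k → Gr K T' k) := fun _ hv₀ =>
  ⟨fun v j => e (v j), isPolynomialMap_linearMap (e.toLinearMap.compLeft (Fin k)),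
    hv₀.map' e.toLinearMap e.ker, fun v hv hg => Gr.map_ofFrame e v hv hg⟩

/-- One factor already recovers `τ` through the inverse isomorphism; the image is cut out by the
condition that the other factors correspond to this one. -/
theorem isGrassmannianEmbedding_of_equiv [∀ i, FiniteDimensional K (S i)] [Nonempty ι]
    (e : ∀ i, T ≃ₗ[K] S i) :
    IsGrassmannianEmbedding fun (τ : Gr K T k) (i : ι) => Gr.map (e i) τ := by
  obtain ⟨i₀⟩ := ‹Nonempty ι›
  have hleft : Function.LeftInverse (fun w : ∀ i, Gr K (S i) k => Gr.map (e i₀).symm (w i₀))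
      fun (τ : Gr K T k) (i : ι) => Gr.map (e i) τ := fun τ => Gr.map_symm_map (e i₀) τ
  refine ⟨hleft.injective, fun i => isRegularMap_map (e i), ?_, _, hleft, ?_⟩
  · let c (i : ι) : S i₀ ≃ₗ[K] S i := (e i₀).symm.trans (e i)
    -- Prepending the transported vector to the frame `w i` gives a dependent family exactly when
    -- that vector lies in the span of the frame.
    let X (i : ι) (j : Fin k) (w : ∀ i, Fin k → S i) : Fin (k + 1) → S i :=
      Fin.cons (c i (w i₀ j)) (w i)
    refine ⟨{E | ∃ (i : ι) (j : Fin k) (θ : Fin (k + 1) → Module.Dual K (S i)),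
      E = fun w => (Matrix.of fun a b => θ a (X i j w b)).det}, ?_, fun w hw => ?_⟩
    · rintro _ ⟨i, j, θ, rfl⟩
      let Y : Fin (k + 1) → (∀ i, Fin k → S i) →ₗ[K] S i :=
        Fin.cons ((c i).toLinearMap ∘ₗ LinearMap.proj j ∘ₗ LinearMap.proj i₀)
          fun b => LinearMap.proj b ∘ₗ LinearMap.proj i
      have hY (b : Fin (k + 1)) (w : ∀ i, Fin k → S i) : X i j w b = Y b w := by
        induction b using Fin.cases <;> simp [X, Y]
      simp only [hY]
      exact det_mem_polyFunctions fun a b => θ a ∘ₗ Y b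
    · have hiff : (∀ E ∈ {E | ∃ (i : ι) (j : Fin k) (θ : Fin (k + 1) → Module.Dual K (S i)),
          E = fun w => (Matrix.of fun a b => θ a (X i j w b)).det}, E w = 0) ↔
          ∀ i j, c i (w i₀ j) ∈ Submodule.span K (Set.range (w i)) := by
        constructor
        · intro h i j
          by_contra hmem
          obtain ⟨θ, hθ⟩ := (exists_det_ne_zero_iff (X i j w)).2
            (linearIndependent_finCons.2 ⟨hw i, hmem⟩)
          exact hθ (h _ ⟨i, j, θ, rfl⟩)
        · rintro h _ ⟨i, j, θ, rfl⟩
          by_contra hθ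
          exact (linearIndependent_finCons.1 ((exists_det_ne_zero_iff (X i j w)).1 ⟨θ, hθ⟩)).2
            (h i j)
      rw [hiff]
      constructor
      · rintro ⟨τ, hτ⟩ i j
        have h0 : τ.1.map (e i₀).toLinearMap = Submodule.span K (Set.range (w i₀)) :=
          congrArg Subtype.val (congrFun hτ i₀)
        have h1 : τ.1.map (e i).toLinearMap = Submodule.span K (Set.range (w i)) :=
          congrArg Subtype.val (congrFun hτ i)
        have hmem : w i₀ j ∈ τ.1.map (e i₀).toLinearMap := h0 ▸ Submodule.subset_span ⟨j, rfl⟩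
        obtain ⟨t, ht, htw⟩ := hmem
        rw [← h1, ← htw]
        exact ⟨t, ht, by simp [c]⟩
      · intro h
        refine ⟨Gr.map (e i₀).symm (Gr.ofFrame (w i₀) (hw i₀)), funext fun i => Subtype.ext ?_⟩
        change ((Submodule.span K (Set.range (w i₀))).map (e i₀).symm.toLinearMap).map
          (e i).toLinearMap = Submodule.span K (Set.range (w i))
        rw [← Submodule.map_comp]
        refine Submodule.eq_of_le_of_finrank_le ?_ ?_
        · rw [Submodule.map_span, Submodule.span_le]
          rintro _ ⟨_, ⟨j, rfl⟩, rfl⟩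
          exact h i j
        · change _ ≤ Module.finrank K ((Submodule.span K (Set.range (w i₀))).map (c i).toLinearMap)
          rw [LinearEquiv.finrank_map_eq, finrank_span_eq_card (hw i), finrank_span_eq_card (hw i₀)]
  · intro w₀ hw₀ _
    refine ⟨fun w j => (e i₀).symm (w i₀ j), isPolynomialMap_linearMap
      ((e i₀).symm.toLinearMap.compLeft (Fin k) ∘ₗ
        (LinearMap.proj i₀ : (∀ i, Fin k → S i) →ₗ[K] (Fin k → S i₀))),
      (hw₀ i₀).map' (e i₀).symm.toLinearMap (e i₀).symm.ker, fun w hw hg _ => ?_⟩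
    exact Gr.map_ofFrame (e i₀).symm (w i₀) (hw i₀) hg

instance subsingleton_gr_zero [FiniteDimensional K T] : Subsingleton (Gr K T 0) :=
  ⟨fun τ ρ => Subtype.ext <|
    (Submodule.finrank_eq_zero.1 τ.2).trans (Submodule.finrank_eq_zero.1 ρ.2).symm⟩

/-- Covers `n = 0`, where no node other than `p` exists and the left inverse cannot be read off a
factor; all Grassmannians involved are points. -/
theorem isGrassmannianEmbedding_of_eq_zero [FiniteDimensional K T] [∀ i, FiniteDimensional K (S i)]
    (hk : k = 0) (Δ : Gr K T k → ∀ i, Gr K (S i) k) : IsGrassmannianEmbedding Δ := by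
  subst hk
  let τ₀ : Gr K T 0 := ⟨⊥, finrank_bot K T⟩
  refine ⟨fun _ _ _ => Subsingleton.elim _ _, fun i _ _ => ?_, ⟨∅, by simp, fun w hw => ?_⟩,
    fun _ => τ₀, fun _ => Subsingleton.elim _ _, fun w₀ _ _ => ?_⟩
  · exact ⟨fun _ => 0, isPolynomialMap_linearMap (0 : (Fin 0 → T) →ₗ[K] (Fin 0 → S i)),
      linearIndependent_empty_type, fun _ _ _ => Subsingleton.elim _ _⟩
  · simp only [Set.mem_empty_iff_false, false_imp_iff, implies_true, iff_true]
    exact ⟨τ₀, Subsingleton.elim _ _⟩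
  · exact ⟨fun _ => 0, isPolynomialMap_linearMap (0 : (∀ i, Fin 0 → S i) →ₗ[K] (Fin 0 → T)),
      linearIndependent_empty_type, fun _ _ _ _ => Subsingleton.elim _ _⟩

end Embedding

end CageVarieties

/-! ### Proof of the main theorem -/

namespace CageVarieties

theorem Cage.exists_ne_node {K : Type*} [Field K] {n d : ℕ} (C : Cage K n d) (hn : n ≠ 0)
    (hd : 2 ≤ d) (p : PSpace K n) : ∃ q, q ∈ C.nodes ∧ q ≠ p := by
  by_contra! h
  have h1 : C.nodes.ncard ≤ 1 :=
    (Set.ncard_le_ncard (t := {p}) fun q hq => h q hq).trans (Set.ncard_singleton p).le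
  rw [Cage.nodes, C.ncard_nodeSet] at h1
  exact absurd h1 (not_le.2 (Nat.one_lt_pow hn hd))

end CageVarieties

theorem corollary2p3 {𝕜 : Type*} [RCLike 𝕜] {n d s : ℕ} (hs : s ≤ n)
    (C : CageVarieties.Cage 𝕜 n d) (p : CageVarieties.PSpace 𝕜 n) (hp : p ∈ C.nodes) :
    -- existence and uniqueness
    (∀ τ : CageVarieties.Gr 𝕜 (CageVarieties.Tangent p) (n - s),
      ∃! V : Set (CageVarieties.PSpace 𝕜 n),
        CageVarieties.IsCompleteIntersection (fun _ : Fin s => d) V ∧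
        C.nodes ⊆ V ∧ CageVarieties.tangentSpace V p = τ.1) ∧
    -- a supra-simplicial set of nodes suffices to determine the same variety
    (∀ A : Set (CageVarieties.PSpace 𝕜 n), C.IsSupraSimplicial A →
      ∀ τ : CageVarieties.Gr 𝕜 (CageVarieties.Tangent p) (n - s),
      ∃! V : Set (CageVarieties.PSpace 𝕜 n),
        CageVarieties.IsCompleteIntersection (fun _ : Fin s => d) V ∧
        A ⊆ V ∧ CageVarieties.tangentSpace V p = τ.1) ∧
    -- the diagonal map of Grassmannians, and its being an embedding
    (∃ Δ : CageVarieties.Gr 𝕜 (CageVarieties.Tangent p) (n - s) →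
        ∀ q : {q : CageVarieties.PSpace 𝕜 n // q ∈ C.nodes ∧ q ≠ p},
          CageVarieties.Gr 𝕜 (CageVarieties.Tangent q.1) (n - s),
      (∀ (τ : CageVarieties.Gr 𝕜 (CageVarieties.Tangent p) (n - s))
        (V : Set (CageVarieties.PSpace 𝕜 n)),
        CageVarieties.IsCompleteIntersection (fun _ : Fin s => d) V →
        C.nodes ⊆ V → CageVarieties.tangentSpace V p = τ.1 →
        ∀ q, (Δ τ q).1 = CageVarieties.tangentSpace V q.1) ∧
      (2 ≤ d → CageVarieties.IsGrassmannianEmbedding Δ)) := by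
  open CageVarieties in
  obtain ⟨φ, x, hg⟩ := C.exists_grid
  have hne : C.nodes.Nonempty := ⟨p, hp⟩
  have hf := hg.isNodal hne
  have hW (τ : Gr 𝕜 (Tangent p) (n - s)) :
      Module.finrank 𝕜 (τ.1.map (hf.tangentEquiv hp).toLinearMap) = n - s := by
    rw [LinearEquiv.finrank_map_eq, τ.2]
  -- The coefficient space is forced: it is the complement of `τ` in the coordinates at `p`.
  let V (τ : Gr 𝕜 (Tangent p) (n - s)) : Set (PSpace 𝕜 n) :=
    baseLocus (colorForm φ) (dotPerp (τ.1.map (hf.tangentEquiv hp).toLinearMap))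
  have hVci (τ) : IsCompleteIntersection (fun _ : Fin s => d) (V τ) :=
    hf.isCompleteIntersection_baseLocus hne hs _ <| by
      have := finrank_dotPerp (τ.1.map (hf.tangentEquiv hp).toLinearMap)
      have := hW τ
      omega
  have hVnodes (τ) : C.nodes ⊆ V τ := hf.subset_baseLocus _
  have hVtan (τ) {q : PSpace 𝕜 n} (hq : q ∈ C.nodes) : tangentSpace (V τ) q =
      τ.1.map ((hf.tangentEquiv hp).trans (hf.tangentEquiv hq).symm).toLinearMap := by
    rw [hf.tangentSpace_baseLocus hs _ (hW τ) hq, ← Submodule.map_comp]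
    rfl
  have hVp (τ) : tangentSpace (V τ) p = τ.1 := by
    rw [hVtan τ hp]
    simp
  have huniq (τ : Gr 𝕜 (Tangent p) (n - s)) (Y : Set (PSpace 𝕜 n))
      (hY : IsCompleteIntersection (fun _ : Fin s => d) Y)
      (hspan : ∀ h : MvPolynomial (Fin (n + 1)) 𝕜, h.IsHomogeneous d →
        (∀ x ∈ Y, Vanishes h x) → h ∈ Ideal.span (Set.range (colorForm φ)))
      (hT : tangentSpace Y p = τ.1) : Y = V τ := by
    have := hf.eq_baseLocus hs hY hspan hp (by rw [hT, τ.2])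
    rwa [hT] at this
  have huniq_nodes (τ : Gr 𝕜 (Tangent p) (n - s)) (Y : Set (PSpace 𝕜 n))
      (hY : IsCompleteIntersection (fun _ : Fin s => d) Y) (hN : C.nodes ⊆ Y)
      (hT : tangentSpace Y p = τ.1) : Y = V τ :=
    huniq τ Y hY (fun h hh hv => hf.mem_span h d hh fun q hq => hv q (hN hq)) hT
  refine ⟨fun τ => ⟨V τ, ⟨hVci τ, hVnodes τ, hVp τ⟩, fun Y hY =>
    huniq_nodes τ Y hY.1 hY.2.1 hY.2.2⟩, fun A hA τ => ?_,
    fun τ q => Gr.map ((hf.tangentEquiv hp).trans (hf.tangentEquiv q.2.1).symm) τ,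
    fun τ Y hY hN hT q => ?_, fun hd => ?_⟩
  · obtain ⟨σ, rfl⟩ := hA
    refine ⟨V τ, ⟨hVci τ, ?_, hVp τ⟩, fun Y hY => huniq τ Y hY.1 (fun h hh hv => ?_) hY.2.2⟩
    · rintro q ⟨c, -, hc⟩
      exact hVnodes τ ⟨_, hc⟩
    -- Supra-simplicial is index sum at most `d`, exactly what interpolation needs in degree `d`.
    · exact hg.mem_span_of_simplicial hne σ hh fun c hc =>
        hv _ (hY.2.1 ⟨c, hc, hg.submodule_eq _⟩)
  · rw [huniq_nodes τ Y hY hN hT]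
    exact (hVtan τ q.2.1).symm
  · by_cases hn : n = 0
    · exact isGrassmannianEmbedding_of_eq_zero (by omega) _
    · obtain ⟨q, hq⟩ := C.exists_ne_node hn hd p
      have : Nonempty {q : PSpace 𝕜 n // q ∈ C.nodes ∧ q ≠ p} := ⟨⟨q, hq⟩⟩
      exact isGrassmannianEmbedding_of_equiv _
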